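/- Let $S^1=\mathbb{R}/\mathbb{Z}$ be the circle of length $1$ (with $\theta$ corresponding to $e^{2\pi i\theta}$), let $(f_n)_{n\in\mathbb{Z}}$ be the orthonormal basis of $L^2(S^1)$ given by $f_0=1$, $f_n(\theta)=\sqrt2\cos(2\pi n\theta)$ for $n>0$ and $f_n(\theta)=\sqrt2\sin(2\pi n\theta)$ for $n<0$, which consists of eigenfunctions of $-\Delta$ with eigenvalues $\lambda_n=4\pi^2n^2$. For $\nu,\sigma,\alpha>0$, the Matérn covariogram on $S^1$ with smoothness $\nu$, spatial variance $\sigma^2$ and decay parameter $\alpha$ is $$k(x,y)=\frac{\sigma^2}{C_{\nu,\alpha}}\sum_{n\in\mathbb{Z}}(2\nu\alpha^2+\lambda_n)^{-\nu-1/2}f_n(x)f_n(y),\qquad C_{\nu,\alpha}=\int_{S^1}\sum_{n\in\mathbb{Z}}(2\nu\alpha^2+\lambda_n)^{-\nu-1/2}f_n(x)^2\,dx ,$$ and $P_{\sigma^2,\alpha}$ denotes the Gaussian measure with this covariogram, i.e. the law of a zero-mean Gaussian process $(Z(x))_{x\in S^1}$ with covariance function $k$, on $\mathbb{R}^{S^1}$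 with the $\sigma$-algebra generated by the evaluations $Z\mapsto Z(x)$. Let $\nu=1/2$. For all $\sigma,\alpha>0$ the measure $P_{\sigma^2,\alpha}$ exists. For all $\sigma_1,\alpha_1,\sigma_2,\alpha_2>0$, the measures $P_{\sigma_1^2,\alpha_1}$ and $P_{\sigma_2^2,\alpha_2}$ are equivalent (each is absolutely continuous with respect to the other) if and only if $$\sigma_1^2\,\alpha_1\tanh(\alpha_1/2)=\sigma_2^2\,\alpha_2\tanh(\alpha_2/2).$$ Moreover, neither $\sigma^2$ nor $\alpha$ can be consistently estimated: there is no sequence $(T_n)$ of real-valued measurable functions of the sample path $Z$ (in particular, of observations $Z(x_1),\dots,Z(x_n)$ at any points of $S^1$) such that, for all $\sigma,\alpha>0$, $T_n\to\sigma^2$ in $P_{\sigma^2,\alpha}$-probability; and there is none such that, for all $\sigma,\alpha>0$, $T_n\to\alpha$ in $P_{\sigma^2,\alpha}$-probability. -/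

import Mathlib

open MeasureTheory ProbabilityTheory Filter

/-! The circle `S¹` is `UnitAddCircle = ℝ / ℤ`, the flat circle of length `1`
(the class of `θ` is the point `exp (2 π i θ)`), with its length measure `volume`. -/

noncomputable section

/-- The standard real orthonormal basis of `L²(S¹)` of eigenfunctions of `-Δ`:
`1` for `n = 0`, `√2 cos (2 π n θ)` for `n > 0` and `√2 sin (2 π n θ)` for `n < 0`. -/
def circleEigenfunction (n : ℤ) (x : UnitAddCircle) : ℝ :=
  if n = 0 then 1
  else if 0 < n then √2 * (fourier n x).re
  else √2 * (fourier n x).im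

/-- The eigenvalue of `-Δ` on the eigenfunction with index `n`. -/
def circleEigenvalue (n : ℤ) : ℝ := 4 * Real.pi ^ 2 * (n : ℝ) ^ 2

/-- The unnormalised spectral weight `(2 ν α² + λₙ) ^ (-ν - d / 2)` with `d = 1`. -/
def maternWeight (ν α : ℝ) (n : ℤ) : ℝ :=
  (2 * ν * α ^ 2 + circleEigenvalue n) ^ (-ν - 1 / 2)

/-- The normalising constant `C_{ν,α}`: the mean over the circle of the unnormalised variance. -/
def maternConst (ν α : ℝ) : ℝ :=
  ⨍ x : UnitAddCircle, ∑' n : ℤ, maternWeight ν α n * circleEigenfunction n x ^ 2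

/-- The Matérn covariogram on the circle with smoothness `ν`, decay `α`, spatial variance `σ²`. -/
def maternCovariogram (ν σ α : ℝ) (x y : UnitAddCircle) : ℝ :=
  σ ^ 2 / maternConst ν α *
    ∑' n : ℤ, maternWeight ν α n * circleEigenfunction n x * circleEigenfunction n y

/-- `P` is the Gaussian measure with the Matérn covariogram: the law, on `ℝ^{S¹}` with the
`σ`-algebra generated by the evaluations `Z ↦ Z x`, of a zero-mean Gaussian process on the circle
with covariance function `maternCovariogram ν σ α`. -/
structure IsMaternMeasure (ν σ α : ℝ) (P : Measure (UnitAddCircle → ℝ)) : Prop where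
  isGaussianProcess : IsGaussianProcess (fun (x : UnitAddCircle) (Z : UnitAddCircle → ℝ) ↦ Z x) P
  mean_eq_zero : ∀ x : UnitAddCircle, ∫ Z, Z x ∂P = 0
  covariance_eq : ∀ x y : UnitAddCircle,
    cov[fun Z : UnitAddCircle → ℝ ↦ Z x, fun Z : UnitAddCircle → ℝ ↦ Z y; P]
      = maternCovariogram ν σ α x y

/-- The function `g σ α` of the parameters of the Matérn family with known smoothness `ν` is
consistently estimable: some sequence of estimators converges to it in probability, whatever the
true parameters `σ, α > 0` are. An estimator is any measurable function of the sample path; this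
includes the functions of finitely many observations `Z x₁, …, Z xₙ`, for any choice of `xᵢ`. -/
def ConsistentlyEstimable (ν : ℝ) (g : ℝ → ℝ → ℝ) : Prop :=
  ∃ T : ℕ → (UnitAddCircle → ℝ) → ℝ, (∀ n, Measurable (T n)) ∧
    ∀ σ α : ℝ, 0 < σ → 0 < α → ∀ P : Measure (UnitAddCircle → ℝ), IsMaternMeasure ν σ α P →
      TendstoInMeasure P T atTop (fun _ ↦ g σ α)

end

/-!
For `ν = 1 / 2` the covariogram is `∑ sₙ fₙ(x) fₙ(y)` with `sₙ = 2 A / (α² + 4 π² n²)` and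
`A = σ² α tanh (α / 2)`; summing the Fourier series of `cosh (α (θ - 1 / 2))` gives both this
normalisation and the closed form `σ² cosh (α (θ - 1 / 2)) / cosh (α / 2)` in the angle `θ ∈ [0, 1]`
between the two points.

*Existence.* Under the product of the Gaussian measures of variances `sₙ` on the sequences of
Fourier coefficients `(aₙ)`, the series `∑ aₙ fₙ(x)` converges in `L²` at every point `x`, and the
limits form a Gaussian process with the right covariance (`isMaternMeasure_map`).

*Equal `A` implies equivalence.* If the two parameters share `A`, then the precisions `1 / sₙ` differ
by a constant `2 c` that does not depend on `n`. The product measure for the larger `α` is hence the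
one for the smaller `α` weighted by a multiple of `exp (-c ∑ aₙ²)`. As `∑ aₙ²` is almost surely
finite, this density is positive, so the product measures are equivalent
(`infinitePi_gaussianReal_absolutelyContinuous`). Convergence in measure is the same for equivalent
finite measures, so one map from coefficients to sample paths produces both Matérn laws, which are
therefore equivalent.

*Equivalence implies equal `A`.* The quadratic variation of the path along the points `j / N`
converges to `2 A` in probability: distinct increments have covariance `O(N⁻²)`, by an exact formula
for the second differences of `cosh`, and Isserlis' theorem turns this into a bound on the variance
(`IsMaternMeasure.tendstoInMeasure_quadraticVariation`). A statistic cannot have two different limits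
under equivalent measures.

*No consistent estimation.* For the same reason a consistently estimable function of the parameters
depends on `A` only, while there are parameters with the same `A` and different `σ²` and `α`.
-/

noncomputable section

open scoped Topology ENNReal NNReal

/-! ### The covariogram for smoothness `1 / 2` in closed form -/

lemma maternWeight_half (α : ℝ) (n : ℤ) :
    maternWeight (1 / 2) α n = (α ^ 2 + 4 * Real.pi ^ 2 * (n : ℝ) ^ 2)⁻¹ := by
  rw [maternWeight, circleEigenvalue]
  norm_num
  rw [Real.rpow_neg_one]

lemma summable_maternWeight_half {α : ℝ} (hα : 0 < α) :
    Summable (fun n : ℤ ↦ maternWeight (1 / 2) α n) := by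
  simp_rw [maternWeight_half]
  have h : Summable (fun n : ℤ ↦ 1 / (n : ℝ) ^ 2) := Real.summable_one_div_int_pow.2 (by norm_num)
  refine .of_norm_bounded_eventually h ?_
  have h0 : ∀ᶠ n : ℤ in cofinite, n ≠ 0 := by
    simpa using (Set.finite_singleton (0 : ℤ)).eventually_cofinite_notMem
  filter_upwards [h0] with n hn
  have hn' : 0 < (n : ℝ) ^ 2 := by positivity
  rw [Real.norm_of_nonneg (by positivity), one_div]
  refine inv_anti₀ hn' ?_
  have hpi : 1 ≤ 4 * Real.pi ^ 2 := by nlinarith [Real.pi_gt_three]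
  nlinarith [mul_le_mul_of_nonneg_right hpi hn'.le, sq_nonneg α]

/-- The weights of the Matérn spectrum are, up to a factor, the Fourier coefficients of a `cosh`. -/
lemma fourierCoeff_cosh {α : ℝ} (hα : 0 < α) (n : ℤ) :
    fourierCoeff (AddCircle.liftIco 1 0 (fun x : ℝ ↦ (Complex.cosh (α * (x - 1 / 2)) : ℂ))) n =
      ((2 * α * Real.sinh (α / 2) * maternWeight (1 / 2) α n : ℝ) : ℂ) := by
  rw [fourierCoeff_liftIco_eq, fourierCoeffOn_eq_integral]
  set l : ℂ := 2 * Real.pi * Complex.I * n with hl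
  have hl2 : l ^ 2 = -(4 * Real.pi ^ 2 * n ^ 2) := by
    rw [hl]; ring_nf; rw [Complex.I_sq]; ring
  have hne : (α : ℂ) ^ 2 - l ^ 2 ≠ 0 := by
    rw [hl2]
    have : (0 : ℝ) < α ^ 2 + 4 * Real.pi ^ 2 * (n : ℝ) ^ 2 := by positivity
    exact_mod_cast (by linarith : (0 : ℝ) < α ^ 2 - -(4 * Real.pi ^ 2 * (n : ℝ) ^ 2)).ne'
  -- an antiderivative of `exp (-l x) cosh (α (x - 1 / 2))`, found by integrating by parts twice
  have hderiv : ∀ x : ℂ, HasDerivAt (fun x : ℂ ↦ Complex.exp (-l * x) *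
      (α * Complex.sinh (α * (x - 1 / 2)) + l * Complex.cosh (α * (x - 1 / 2))) /
        ((α : ℂ) ^ 2 - l ^ 2))
      (Complex.exp (-l * x) * Complex.cosh (α * (x - 1 / 2))) x := by
    intro x
    have h1 : HasDerivAt (fun x : ℂ ↦ (α : ℂ) * (x - 1 / 2)) α x := by
      simpa using ((hasDerivAt_id x).sub_const (1 / 2 : ℂ)).const_mul (α : ℂ)
    have h2 : HasDerivAt (fun x : ℂ ↦ -l * x) (-l) x := by
      simpa using (hasDerivAt_id x).const_mul (-l)
    convert! (h2.cexp.mul ((h1.csinh.const_mul (α : ℂ)).add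
      (h1.ccosh.const_mul l))).div_const ((α : ℂ) ^ 2 - l ^ 2) using 1
    field_simp
    simp only [Pi.add_apply]
    ring_nf
  have hint : ∫ x in (0 : ℝ)..(0 + 1),
      fourier (-n) (x : AddCircle (0 + 1 - 0 : ℝ)) • Complex.cosh (α * (x - 1 / 2)) =
      ∫ x in (0 : ℝ)..1, Complex.exp (-l * x) * Complex.cosh (α * (x - 1 / 2)) := by
    rw [zero_add]
    refine intervalIntegral.integral_congr fun x _ ↦ ?_
    simp only [fourier_coe_apply, smul_eq_mul]
    congr 2
    push_cast
    rw [hl]; ring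
  rw [hint, intervalIntegral.integral_eq_sub_of_hasDerivAt
    (fun x _ ↦ (hderiv x).comp_ofReal) (Continuous.intervalIntegrable (by fun_prop) _ _)]
  have he : Complex.exp (-l) = 1 := by
    rw [Complex.exp_eq_one_iff]
    exact ⟨-n, by rw [hl]; push_cast; ring⟩
  rw [maternWeight_half]
  have hs : (α : ℂ) * (0 - 1 / 2) = -(α / 2) := by ring
  have hs' : (α : ℂ) * (1 - 1 / 2) = (α / 2) := by ring
  simp only [Complex.ofReal_one, mul_one, Complex.ofReal_zero, mul_zero, he, hs, hs',
    Complex.exp_zero, Complex.sinh_neg, Complex.cosh_neg]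
  push_cast
  have : (α : ℂ) ^ 2 + 4 * Real.pi ^ 2 * n ^ 2 = α ^ 2 - l ^ 2 := by rw [hl2]; ring
  rw [this]
  simp
  field_simp
  ring

/-- The Fourier series of `θ ↦ cosh (α (θ - 1 / 2))`, extended periodically from `[0, 1]`. -/
lemma hasSum_maternWeight_mul_fourier {α : ℝ} (hα : 0 < α) {θ : ℝ} (hθ : θ ∈ Set.Icc 0 1) :
    HasSum (fun n : ℤ ↦ maternWeight (1 / 2) α n * (fourier n (θ : UnitAddCircle)).re)
      (Real.cosh (α * (θ - 1 / 2)) / (2 * α * Real.sinh (α / 2))) := by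
  suffices H : ∀ θ ∈ Set.Ico (0 : ℝ) 1,
      HasSum (fun n : ℤ ↦ maternWeight (1 / 2) α n * (fourier n (θ : UnitAddCircle)).re)
        (Real.cosh (α * (θ - 1 / 2)) / (2 * α * Real.sinh (α / 2))) by
    rcases hθ.2.lt_or_eq with h | rfl
    · exact H θ ⟨hθ.1, h⟩
    · have h1 : ((1 : ℝ) : UnitAddCircle) = ((0 : ℝ) : UnitAddCircle) := by
        rw [AddCircle.coe_period, QuotientAddGroup.mk_zero]
      have h2 : α * (0 - 1 / 2) = -(α * (1 - 1 / 2)) := by ring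
      simpa only [h1, h2, Real.cosh_neg] using H 0 (by simp)
  intro θ hθ
  have hc : Continuous (AddCircle.liftIco 1 0 (fun x : ℝ ↦ Complex.cosh (α * (x - 1 / 2)))) := by
    refine AddCircle.liftIco_continuous ?_ (by fun_prop)
    have : (α : ℂ) * ((0 : ℝ) - 1 / 2) = -(α * ((0 + 1 : ℝ) - 1 / 2)) := by push_cast; ring
    rw [this, Complex.cosh_neg]
  have hS : 0 < Real.sinh (α / 2) := Real.sinh_pos_iff.2 (by positivity)
  have key := has_pointwise_sum_fourier_series_of_summable
    (f := ⟨AddCircle.liftIco 1 0 (fun x : ℝ ↦ Complex.cosh (α * (x - 1 / 2))), hc⟩) (by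
      refine Summable.congr ?_ fun n ↦ (fourierCoeff_cosh hα n).symm
      exact (Complex.hasSum_ofReal.2 ((summable_maternWeight_half hα).mul_left _).hasSum).summable)
    (θ : UnitAddCircle)
  simp only [ContinuousMap.coe_mk, fourierCoeff_cosh hα] at key
  rw [AddCircle.liftIco_zero_coe_apply hθ] at key
  have key' := Complex.hasSum_re key
  convert! key'.div_const (2 * α * Real.sinh (α / 2)) using 1
  · ext n
    rw [smul_eq_mul, Complex.re_ofReal_mul]
    field_simp
  · congr 1
    have : (α : ℂ) * (θ - 1 / 2) = ((α * (θ - 1 / 2) : ℝ) : ℂ) := by push_cast; ring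
    rw [this, Complex.cosh_ofReal_re]

lemma circleEigenfunction_mul_add_neg (n : ℤ) (x y : UnitAddCircle) :
    circleEigenfunction n x * circleEigenfunction n y +
      circleEigenfunction (-n) x * circleEigenfunction (-n) y = 2 * (fourier n (x - y)).re := by
  have h : (fourier n (x - y)).re =
      (fourier n x).re * (fourier n y).re + (fourier n x).im * (fourier n y).im := by
    have h2 : fourier n (x - y) = fourier n x * (starRingEnd ℂ) (fourier n y) := by
      rw [sub_eq_add_neg, fourier_apply, smul_add, AddCircle.toCircle_add, Circle.coe_mul,
        ← fourier_apply, smul_neg, ← neg_smul, ← fourier_apply, fourier_neg]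
    rw [h2, Complex.mul_re, Complex.conj_re, Complex.conj_im]
    ring
  have hsq : √(2 : ℝ) * √2 = 2 := Real.mul_self_sqrt (by norm_num)
  rw [h]
  rcases lt_trichotomy n 0 with hn | rfl | hn
  · simp only [circleEigenfunction, hn.ne, hn.not_gt, if_false, neg_eq_zero, Left.neg_pos_iff, hn,
      if_true, fourier_neg, Complex.conj_re]
    linear_combination ((fourier n x).re * (fourier n y).re + (fourier n x).im * (fourier n y).im)
      * hsq
  · simp [circleEigenfunction]; norm_num
  · simp only [circleEigenfunction, hn.ne', hn, if_false, neg_eq_zero, Left.neg_pos_iff, hn.not_gt,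
      if_true, fourier_neg, Complex.conj_im]
    linear_combination ((fourier n x).re * (fourier n y).re + (fourier n x).im * (fourier n y).im)
      * hsq

lemma abs_circleEigenfunction_le (n : ℤ) (x : UnitAddCircle) :
    |circleEigenfunction n x| ≤ √2 := by
  have h1 : ‖fourier n x‖ = 1 := by rw [fourier_apply]; exact Circle.norm_coe _
  have h2 : (1 : ℝ) ≤ √2 := Real.one_le_sqrt.2 (by norm_num)
  unfold circleEigenfunction
  split_ifs
  · rwa [abs_one]
  · rw [abs_mul, abs_of_nonneg (by positivity : 0 ≤ √(2 : ℝ))]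
    exact mul_le_of_le_one_right (by positivity) ((Complex.abs_re_le_norm _).trans h1.le)
  · rw [abs_mul, abs_of_nonneg (by positivity : 0 ≤ √(2 : ℝ))]
    exact mul_le_of_le_one_right (by positivity) ((Complex.abs_im_le_norm _).trans h1.le)

lemma summable_weight_mul_circleEigenfunction {w : ℤ → ℝ} (hw : Summable w) (x y : UnitAddCircle) :
    Summable (fun n ↦ w n * circleEigenfunction n x * circleEigenfunction n y) := by
  refine .of_norm_bounded (hw.norm.mul_right 2) fun n ↦ ?_
  rw [mul_assoc, norm_mul]
  refine mul_le_mul_of_nonneg_left ?_ (norm_nonneg _)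
  rw [Real.norm_eq_abs, abs_mul]
  calc _ ≤ √2 * √2 := mul_le_mul (abs_circleEigenfunction_le n x) (abs_circleEigenfunction_le n y)
        (abs_nonneg _) (by positivity)
    _ = 2 := Real.mul_self_sqrt (by norm_num)

lemma tsum_maternWeight_mul_circleEigenfunction {α : ℝ} (hα : 0 < α) {x y : UnitAddCircle} {θ : ℝ}
    (hθ : θ ∈ Set.Icc 0 1) (hxy : x - y = (θ : UnitAddCircle)) :
    ∑' n : ℤ, maternWeight (1 / 2) α n * circleEigenfunction n x * circleEigenfunction n y =
      Real.cosh (α * (θ - 1 / 2)) / (2 * α * Real.sinh (α / 2)) := by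
  have hs := summable_weight_mul_circleEigenfunction (summable_maternWeight_half hα) x y
  have h1 := hs.hasSum
  have h2 := (Equiv.neg ℤ).hasSum_iff.2 h1
  have h3 := (hasSum_maternWeight_mul_fourier hα hθ).mul_left 2
  -- the terms of index `n` and `-n` add up to a function of `x - y`
  have h4 := h1.add h2
  have h5 : (fun n : ℤ ↦ maternWeight (1 / 2) α n * circleEigenfunction n x *
      circleEigenfunction n y + ((fun n : ℤ ↦ maternWeight (1 / 2) α n * circleEigenfunction n x *
      circleEigenfunction n y) ∘ (Equiv.neg ℤ)) n) = fun n : ℤ ↦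
      2 * (maternWeight (1 / 2) α n * (fourier n (θ : UnitAddCircle)).re) := by
    ext n
    have := circleEigenfunction_mul_add_neg n x y
    have hw : maternWeight (1 / 2) α (-n) = maternWeight (1 / 2) α n := by
      rw [maternWeight_half, maternWeight_half]; simp
    rw [hxy] at this
    simp only [Function.comp_apply, Equiv.neg_apply, hw]
    linear_combination maternWeight (1 / 2) α n * this
  rw [h5] at h4
  have := h4.unique h3
  linarith

lemma maternConst_half {α : ℝ} (hα : 0 < α) :
    maternConst (1 / 2) α = Real.cosh (α / 2) / (2 * α * Real.sinh (α / 2)) := by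
  have h : ∀ x : UnitAddCircle, ∑' n : ℤ, maternWeight (1 / 2) α n * circleEigenfunction n x ^ 2 =
      Real.cosh (α / 2) / (2 * α * Real.sinh (α / 2)) := by
    intro x
    have := tsum_maternWeight_mul_circleEigenfunction hα (x := x) (y := x) (θ := 0) (by simp)
      (by simp)
    have h2 : α * (0 - 1 / 2) = -(α / 2) := by ring
    rw [h2, Real.cosh_neg] at this
    rw [← this]
    congr 1; ext n; ring
  simp only [maternConst, h]
  exact average_const _ _

/-- The covariogram as a function of the angle `θ ∈ [0, 1]` between the two points. -/
lemma maternCovariogram_half_eq_cosh {α : ℝ} (hα : 0 < α) (σ : ℝ) {x y : UnitAddCircle} {θ : ℝ}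
    (hθ : θ ∈ Set.Icc 0 1) (hxy : x - y = (θ : UnitAddCircle)) :
    maternCovariogram (1 / 2) σ α x y =
      σ ^ 2 * (Real.cosh (α * (θ - 1 / 2)) / Real.cosh (α / 2)) := by
  rw [maternCovariogram, tsum_maternWeight_mul_circleEigenfunction hα hθ hxy, maternConst_half hα]
  have hS : 0 < Real.sinh (α / 2) := Real.sinh_pos_iff.2 (by positivity)
  have hC := Real.cosh_pos (α / 2)
  field_simp

/-- The parameter that the sample paths determine: by `maternCovariogram_half_eq_tsum` it is,
up to the factor `2`, the coefficient of the leading term of the spectrum at high frequency. -/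
def microergodic (σ α : ℝ) : ℝ := σ ^ 2 * α * Real.tanh (α / 2)

lemma microergodic_pos {σ α : ℝ} (hσ : 0 < σ) (hα : 0 < α) : 0 < microergodic σ α := by
  have : 0 < Real.tanh (α / 2) := by
    rw [Real.tanh_eq_sinh_div_cosh]
    exact div_pos (Real.sinh_pos_iff.2 (by positivity)) (Real.cosh_pos _)
  unfold microergodic
  positivity

/-- The variances of the Fourier coefficients of a process with parameter `A = microergodic σ α`
and decay `α`. -/
def spectralVar (A α : ℝ) (n : ℤ) : ℝ := 2 * A / (α ^ 2 + 4 * Real.pi ^ 2 * (n : ℝ) ^ 2)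

lemma spectralVar_pos {A α : ℝ} (hA : 0 < A) (hα : 0 < α) (n : ℤ) : 0 < spectralVar A α n := by
  unfold spectralVar; positivity

lemma summable_spectralVar (A : ℝ) {α : ℝ} (hα : 0 < α) : Summable (spectralVar A α) := by
  refine ((summable_maternWeight_half hα).mul_left (2 * A)).congr fun n ↦ ?_
  rw [maternWeight_half, spectralVar, div_eq_mul_inv]

lemma maternCovariogram_half_eq_tsum {α : ℝ} (hα : 0 < α) (σ : ℝ) (x y : UnitAddCircle) :
    maternCovariogram (1 / 2) σ α x y =
      ∑' n, spectralVar (microergodic σ α) α n * circleEigenfunction n x *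
        circleEigenfunction n y := by
  rw [maternCovariogram, maternConst_half hα, ← tsum_mul_left]
  congr 1; ext n
  have hS : 0 < Real.sinh (α / 2) := Real.sinh_pos_iff.2 (by positivity)
  have hC := Real.cosh_pos (α / 2)
  rw [maternWeight_half, spectralVar, microergodic, Real.tanh_eq_sinh_div_cosh]
  field_simp

/-! ### Convergence in measure -/

section TendstoInMeasure

variable {Ω : Type*} {mΩ : MeasurableSpace Ω} {P Q : Measure Ω}

lemma MeasureTheory.TendstoInMeasure.of_absolutelyContinuous [IsFiniteMeasure P] [IsFiniteMeasure Q]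
    {f : ℕ → Ω → ℝ} {g : Ω → ℝ} (h : TendstoInMeasure P f atTop g) (hQP : Q ≪ P)
    (hf : ∀ n, Measurable (f n)) : TendstoInMeasure Q f atTop g := by
  rw [exists_seq_tendstoInMeasure_atTop_iff fun n ↦ (hf n).aestronglyMeasurable] at h ⊢
  intro ns hns
  obtain ⟨ns', h1, h2⟩ := h ns hns
  exact ⟨ns', h1, hQP.ae_le h2⟩

lemma MeasureTheory.TendstoInMeasure.add_real {f f' : ℕ → Ω → ℝ} {g g' : Ω → ℝ}
    (h : TendstoInMeasure P f atTop g) (h' : TendstoInMeasure P f' atTop g') :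
    TendstoInMeasure P (fun n ω ↦ f n ω + f' n ω) atTop (fun ω ↦ g ω + g' ω) := by
  rw [tendstoInMeasure_iff_norm] at h h' ⊢
  intro ε hε
  have := (h (ε / 2) (by positivity)).add (h' (ε / 2) (by positivity))
  rw [add_zero] at this
  refine tendsto_of_tendsto_of_tendsto_of_le_of_le tendsto_const_nhds this (fun _ ↦ zero_le) ?_
  intro n
  refine (measure_mono ?_).trans (measure_union_le _ _)
  intro ω hω
  simp only [Set.mem_ofPred_eq, Set.mem_union, Real.norm_eq_abs] at hω ⊢
  by_contra! hc
  have h3 : f n ω + f' n ω - (g ω + g' ω) = (f n ω - g ω) + (f' n ω - g' ω) := by ring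
  rw [h3] at hω
  have := abs_add_le (f n ω - g ω) (f' n ω - g' ω)
  linarith

lemma MeasureTheory.TendstoInMeasure.const_mul_real {f : ℕ → Ω → ℝ} {g : Ω → ℝ}
    (h : TendstoInMeasure P f atTop g) (c : ℝ) :
    TendstoInMeasure P (fun n ω ↦ c * f n ω) atTop (fun ω ↦ c * g ω) := by
  rw [tendstoInMeasure_iff_norm] at h ⊢
  intro ε hε
  have h1 : 0 < |c| + 1 := by positivity
  refine tendsto_of_tendsto_of_tendsto_of_le_of_le tendsto_const_nhds
    (h (ε / (|c| + 1)) (by positivity)) (fun _ ↦ zero_le) ?_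
  intro n
  refine measure_mono fun ω hω ↦ ?_
  simp only [Set.mem_ofPred_eq, ← mul_sub, norm_mul] at hω ⊢
  rw [div_le_iff₀ h1]
  rw [Real.norm_eq_abs c] at hω
  nlinarith [norm_nonneg (f n ω - g ω)]

lemma MeasureTheory.TendstoInMeasure.sum_const_mul_real {ι : Type*} (I : Finset ι) (c : ι → ℝ)
    {f : ι → ℕ → Ω → ℝ} {g : ι → Ω → ℝ} (h : ∀ i, TendstoInMeasure P (f i) atTop (g i)) :
    TendstoInMeasure P (fun n ω ↦ ∑ i ∈ I, c i * f i n ω) atTop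
      (fun ω ↦ ∑ i ∈ I, c i * g i ω) := by
  classical
  induction I using Finset.induction with
  | empty =>
    simp only [Finset.sum_empty]
    intro ε hε
    simp [hε.ne']
  | insert i I hi ih =>
    simp only [Finset.sum_insert hi]
    exact ((h i).const_mul_real (c i)).add_real ih

/-- A statistic cannot converge to two different constants under two probability measures when one
of them is absolutely continuous with respect to the other. -/
lemma MeasureTheory.TendstoInMeasure.const_eq_of_absolutelyContinuous [IsFiniteMeasure P]
    [IsProbabilityMeasure Q] (hQP : Q ≪ P) {f : ℕ → Ω → ℝ} (hf : ∀ n, Measurable (f n)) {c d : ℝ}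
    (hP : TendstoInMeasure P f atTop (fun _ ↦ c)) (hQ : TendstoInMeasure Q f atTop (fun _ ↦ d)) :
    c = d := by
  have := tendstoInMeasure_ae_unique (hP.of_absolutelyContinuous hQP hf) hQ
  simpa using this

end TendstoInMeasure

/-! ### Gaussian series with independent coefficients -/

section GaussianSeries

variable {ι : Type*} {s : ι → ℝ≥0}

lemma map_sum_mul_infinitePi_gaussianReal (s : ι → ℝ≥0) (b : ι → ℝ) (F : Finset ι) :
    (Measure.infinitePi fun n ↦ gaussianReal 0 (s n)).map (fun a ↦ ∑ n ∈ F, b n * a n) =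
      gaussianReal 0 (∑ n ∈ F, b n ^ 2 * s n).toNNReal := by
  have hb : ∀ n, Measurable (fun a : ι → ℝ ↦ b n * a n) := fun n ↦ by fun_prop
  have hind : iIndepFun (fun n (a : ι → ℝ) ↦ b n * a n)
      (Measure.infinitePi fun n ↦ gaussianReal 0 (s n)) :=
    iIndepFun_infinitePi (X := fun n x ↦ b n * x) (fun n ↦ by fun_prop)
  refine Measure.ext_of_charFun ?_
  ext t
  rw [iIndepFun.charFun_map_fun_finsetSum_eq_prod (fun n _ ↦
    (hb n).aemeasurable) (hind.restrict F),
    Finset.prod_apply, charFun_gaussianReal,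
    Real.coe_toNNReal _ (Finset.sum_nonneg fun n _ ↦ by positivity)]
  have h : ∀ n, charFun ((Measure.infinitePi fun n ↦ gaussianReal 0 (s n)).map
      (fun a ↦ b n * a n)) t = Complex.exp (-((b n ^ 2 * s n : ℝ) * t ^ 2 / 2)) := by
    intro n
    have : (Measure.infinitePi fun n ↦ gaussianReal 0 (s n)).map (fun a ↦ b n * a n) =
        (gaussianReal 0 (s n)).map (fun x ↦ b n * x) := by
      rw [← Measure.infinitePi_map_eval (fun n ↦ gaussianReal 0 (s n)) n,
        Measure.map_map (by fun_prop) (by fun_prop)]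
      rfl
    rw [this, gaussianReal_map_const_mul, charFun_gaussianReal]
    simp
  simp_rw [h]
  rw [← Complex.exp_sum]
  congr 1
  push_cast
  simp only [Finset.sum_neg_distrib, mul_zero, zero_mul, zero_sub, Finset.sum_mul, Finset.sum_div]

/-- A Gaussian series with independent terms has a Gaussian sum: the characteristic functions of the
partial sums converge. -/
lemma map_eq_gaussianReal_of_tendstoInMeasure {b : ι → ℝ} {v : ℝ}
    (hv : HasSum (fun n ↦ b n ^ 2 * s n) v) {F : ℕ → Finset ι} (hF : Tendsto F atTop atTop)
    {Y : (ι → ℝ) → ℝ} (hY : TendstoInMeasure (Measure.infinitePi fun n ↦ gaussianReal 0 (s n))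
      (fun N a ↦ ∑ n ∈ F N, b n * a n) atTop Y) :
    (Measure.infinitePi fun n ↦ gaussianReal 0 (s n)).map Y = gaussianReal 0 v.toNNReal := by
  have hb : ∀ n, Measurable (fun a : ι → ℝ ↦ b n * a n) := fun n ↦ by fun_prop
  have hd := hY.tendstoInDistribution (fun N ↦
    (Finset.measurable_sum (F N) fun n _ ↦ hb n).aemeasurable)
  have hYm := hd.aemeasurable_limit
  have := Measure.isProbabilityMeasure_map (μ := Measure.infinitePi fun n ↦ gaussianReal 0 (s n))
    hYm
  have h := ProbabilityMeasure.tendsto_iff_tendsto_charFun.1 hd.tendsto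
  refine Measure.ext_of_charFun ?_
  ext t
  refine tendsto_nhds_unique (h t) ?_
  simp only [ProbabilityMeasure.coe_mk, map_sum_mul_infinitePi_gaussianReal, charFun_gaussianReal]
  have hc : Continuous fun v : ℝ ↦ Complex.exp (t * (0 : ℝ) * Complex.I
      - ((v.toNNReal : ℝ) : ℂ) * t ^ 2 / 2) := by fun_prop
  exact (hc.tendsto v).comp (hv.comp hF)

/-- Independent centred Gaussian variables form an orthogonal family in `L²`, so a series in them
with square-summable coefficients converges in `L²`, and hence in measure. -/
lemma exists_tendstoInMeasure_sum_mul (hs : ∀ n, 0 < s n) {b : ι → ℝ}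
    (hb : Summable (fun n ↦ b n ^ 2 * s n)) {F : ℕ → Finset ι} (hF : Tendsto F atTop atTop) :
    ∃ Y : (ι → ℝ) → ℝ, Measurable Y ∧
      TendstoInMeasure (Measure.infinitePi fun n ↦ gaussianReal 0 (s n))
        (fun N a ↦ ∑ n ∈ F N, b n * a n) atTop Y := by
  classical
  set Q := Measure.infinitePi fun n ↦ gaussianReal 0 (s n)
  have hs' : ∀ n, 0 < √(s n : ℝ) := fun n ↦ Real.sqrt_pos.2 (hs n)
  have hlaw : ∀ n, HasLaw (fun a : ι → ℝ ↦ a n) (gaussianReal 0 (s n)) Q := fun n ↦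
    ⟨(measurable_pi_apply n).aemeasurable, Measure.infinitePi_map_eval _ n⟩
  have hG : ∀ n, HasGaussianLaw (fun a : ι → ℝ ↦ a n) Q := fun n ↦ (hlaw n).hasGaussianLaw
  have hL : ∀ n, MemLp (fun a : ι → ℝ ↦ (√(s n : ℝ))⁻¹ * a n) 2 Q :=
    fun n ↦ (hG n).memLp_two.const_mul _
  have hE : ∀ n, ∫ a, a n ∂Q = 0 := fun n ↦ by
    rw [(hlaw n).integral_eq, integral_id_gaussianReal]
  have hV : ∀ n, Var[fun a ↦ a n; Q] = s n := fun n ↦ by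
    rw [(hlaw n).variance_eq, variance_id_gaussianReal]
  have hcov : ∀ i j, i ≠ j → ∫ a, a i * a j ∂Q = 0 := fun i j hij ↦ by
    have hI : IndepFun (fun a : ι → ℝ ↦ a i) (fun a ↦ a j) Q :=
      (iIndepFun_infinitePi (P := fun n ↦ gaussianReal 0 (s n)) (X := fun _ x ↦ x)
        (fun n ↦ by fun_prop)).indepFun hij
    have := hI.covariance_eq_zero (hG i).memLp_two (hG j).memLp_two
    rw [covariance_eq_sub (hG i).memLp_two (hG j).memLp_two, hE, hE] at this
    simpa using this
  set e : ι → Lp ℝ 2 Q := fun n ↦ (hL n).toLp with he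
  have hinner : ∀ i j, inner ℝ (e i) (e j) =
      (√(s i : ℝ))⁻¹ * (√(s j : ℝ))⁻¹ * ∫ a, a i * a j ∂Q := by
    intro i j
    rw [L2.inner_def, ← integral_const_mul]
    refine integral_congr_ae ?_
    filter_upwards [(hL i).coeFn_toLp, (hL j).coeFn_toLp] with a hi hj
    rw [he]
    simp only [hi, hj, RCLike.inner_apply, conj_trivial]
    ring
  have hortho : Orthonormal ℝ e := by
    rw [orthonormal_iff_ite]
    intro i j
    rw [hinner]
    split_ifs with hij
    · subst hij
      have := hV i
      rw [variance_of_integral_eq_zero (measurable_pi_apply i).aemeasurable (hE i)] at this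
      have h2 : ∫ a, a i * a i ∂Q = s i := by rw [← this]; congr 1; ext a; ring
      rw [h2, ← mul_inv, Real.mul_self_sqrt (NNReal.coe_nonneg _)]
      exact inv_mul_cancel₀ (by exact_mod_cast (hs i).ne')
    · rw [hcov i j hij, mul_zero]
  have hsum : Summable fun n ↦ (b n * √(s n : ℝ)) • e n := by
    have := hortho.orthogonalFamily.summable_iff_norm_sq_summable (fun n ↦ b n * √(s n : ℝ))
    simp only [LinearIsometry.toSpanSingleton_apply] at this
    rw [this]
    refine hb.congr fun n ↦ ?_
    rw [norm_mul, mul_pow, Real.norm_eq_abs, Real.norm_eq_abs, sq_abs, sq_abs,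
      Real.sq_sqrt (NNReal.coe_nonneg _)]
  have hlim := hsum.hasSum.comp hF
  have hmeas : TendstoInMeasure Q (fun N ↦ ((∑ n ∈ F N, (b n * √(s n : ℝ)) • e n : Lp ℝ 2 Q) :
      (ι → ℝ) → ℝ)) atTop (∑' n, (b n * √(s n : ℝ)) • e n : Lp ℝ 2 Q) :=
    tendstoInMeasure_of_tendsto_Lp hlim
  have hYm := (Lp.aestronglyMeasurable (∑' n, (b n * √(s n : ℝ)) • e n : Lp ℝ 2 Q))
  refine ⟨hYm.mk _, hYm.stronglyMeasurable_mk.measurable, hmeas.congr (fun N ↦ ?_) hYm.ae_eq_mk⟩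
  have h1 : ∀ᵐ a ∂Q, ∀ n ∈ F N, ((b n * √(s n : ℝ)) • e n : Lp ℝ 2 Q) a = b n * a n := by
    rw [eventually_all_finset]
    intro n _
    filter_upwards [Lp.coeFn_smul (b n * √(s n : ℝ)) (e n), (hL n).coeFn_toLp] with a h h'
    rw [h, Pi.smul_apply, he, h', smul_eq_mul]
    have := (hs' n).ne'
    field_simp
  filter_upwards [h1, Lp.coeFn_finsetSum (F N) (fun n ↦ (b n * √(s n : ℝ)) • e n)] with a h h'
  rw [h', Finset.sum_apply]
  exact Finset.sum_congr rfl h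

end GaussianSeries

/-! ### Matérn measures: uniqueness, and construction from Fourier coefficients -/

namespace IsMaternMeasure

variable {ν σ α : ℝ} {P P' : Measure (UnitAddCircle → ℝ)}

lemma isProbabilityMeasure (hP : IsMaternMeasure ν σ α P) : IsProbabilityMeasure P :=
  hP.isGaussianProcess.isProbabilityMeasure

lemma memLp_two (hP : IsMaternMeasure ν σ α P) (x : UnitAddCircle) :
    MemLp (fun Z : UnitAddCircle → ℝ ↦ Z x) 2 P :=
  (hP.isGaussianProcess.hasGaussianLaw_eval x).memLp_two

/-- The finite-dimensional laws are determined by the covariogram. -/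
lemma charFunDual_map_restrict (hP : IsMaternMeasure ν σ α P) (I : Finset UnitAddCircle)
    (L : StrongDual ℝ (I → ℝ)) :
    charFunDual (P.map I.restrict) L = Complex.exp (-(((∑ i, ∑ j, L (Pi.single i 1) *
      L (Pi.single j 1) * maternCovariogram ν σ α i j : ℝ) : ℂ)) / 2) := by
  have := hP.isProbabilityMeasure
  have hG := hP.isGaussianProcess.hasGaussianLaw I
  have hL : ∀ Z : UnitAddCircle → ℝ, L (I.restrict Z) =
      ∑ i : I, L (Pi.single i 1) * Z i := by
    intro Z
    conv_lhs => rw [← ContinuousLinearMap.coe_coe, LinearMap.pi_apply_eq_sum_univ]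
    refine Finset.sum_congr rfl fun i _ ↦ ?_
    simp only [Finset.restrict, smul_eq_mul, ContinuousLinearMap.coe_coe]
    rw [mul_comm]
    congr 2
    ext j
    simp [Pi.single_apply, eq_comm]
  have h := hG.charFunDual_map_eq_fun L
  have hm : ∫ Z, L (I.restrict Z) ∂P = 0 := by
    simp_rw [hL]
    rw [integral_finsetSum _ fun (i : I) _ ↦
      ((hP.memLp_two (i : UnitAddCircle)).integrable one_le_two).const_mul (L (Pi.single i 1))]
    simp [integral_const_mul, hP.mean_eq_zero]
  have hv : Var[fun Z ↦ L (I.restrict Z); P] = ∑ i : I, ∑ j : I, L (Pi.single i 1) *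
      L (Pi.single j 1) * maternCovariogram ν σ α i j := by
    simp_rw [hL]
    rw [variance_fun_sum fun i : I ↦
      (hP.memLp_two (i : UnitAddCircle)).const_mul (L (Pi.single i 1))]
    refine Finset.sum_congr rfl fun i _ ↦ Finset.sum_congr rfl fun j _ ↦ ?_
    rw [covariance_const_mul_left, covariance_const_mul_right, hP.covariance_eq]
    ring
  have h' : (fun Z : UnitAddCircle → ℝ ↦ I.restrict (fun x ↦ Z x)) = I.restrict := rfl
  rw [h'] at h
  rw [h]
  have hm' : ∫ Z : UnitAddCircle → ℝ, (L (I.restrict fun x ↦ Z x)) ∂P = 0 := hm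
  rw [hv, hm']
  congr 1
  simp
  ring

/-- The Gaussian measure with a given covariogram is unique. -/
lemma eq_of_covariogram_eq {ν' σ' α' : ℝ} (hP : IsMaternMeasure ν σ α P)
    (hP' : IsMaternMeasure ν' σ' α' P')
    (h : ∀ x y, maternCovariogram ν σ α x y = maternCovariogram ν' σ' α' x y) : P = P' := by
  have := hP.isProbabilityMeasure
  have := hP'.isProbabilityMeasure
  refine IsProjectiveLimit.unique (P := fun I : Finset UnitAddCircle ↦ P.map I.restrict)
    (fun I ↦ rfl) fun I ↦ ?_
  have h1 : IsProbabilityMeasure (P.map I.restrict) :=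
    Measure.isProbabilityMeasure_map (by fun_prop)
  have h2 : IsProbabilityMeasure (P'.map I.restrict) :=
    Measure.isProbabilityMeasure_map (by fun_prop)
  refine Measure.ext_of_charFunDual ?_
  ext L
  rw [hP.charFunDual_map_restrict, hP'.charFunDual_map_restrict]
  simp_rw [h]

end IsMaternMeasure

/-- A process with independent centred Gaussian Fourier coefficients, whose variances are those of
the Matérn spectrum, has a Matérn law. Its values are the limits in measure of the partial sums of
its Fourier series. -/
lemma isMaternMeasure_map {σ α : ℝ} (hσ : 0 < σ) (hα : 0 < α) {F : ℕ → Finset ℤ}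
    (hF : Tendsto F atTop atTop) {Φ : UnitAddCircle → (ℤ → ℝ) → ℝ} (hΦm : ∀ x, Measurable (Φ x))
    (hΦ : ∀ x, TendstoInMeasure (Measure.infinitePi fun n ↦
      gaussianReal 0 (spectralVar (microergodic σ α) α n).toNNReal)
        (fun N a ↦ ∑ n ∈ F N, circleEigenfunction n x * a n) atTop (Φ x)) :
    IsMaternMeasure (1 / 2) σ α ((Measure.infinitePi fun n ↦
      gaussianReal 0 (spectralVar (microergodic σ α) α n).toNNReal).map fun a x ↦ Φ x a) := by
  classical
  set s : ℤ → ℝ := spectralVar (microergodic σ α) α with hs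
  have hA := microergodic_pos hσ hα
  have hs0 : ∀ n, 0 ≤ s n := fun n ↦ (spectralVar_pos hA hα n).le
  have hsS : Summable s := summable_spectralVar _ hα
  set Q := Measure.infinitePi fun n ↦ gaussianReal 0 (s n).toNNReal with hQ
  have hmeas : Measurable fun (a : ℤ → ℝ) (x : UnitAddCircle) ↦ Φ x a := measurable_pi_lambda _ hΦm
  have hS := fun x y ↦ (summable_weight_mul_circleEigenfunction hsS x y)
  have hk : ∀ x y, HasSum (fun n ↦ s n * circleEigenfunction n x * circleEigenfunction n y)
      (maternCovariogram (1 / 2) σ α x y) := fun x y ↦ by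
    rw [maternCovariogram_half_eq_tsum hα]
    exact (hS x y).hasSum
  -- every finite linear combination of the values is a Gaussian series
  have hlin : ∀ (I : Finset UnitAddCircle) (c : UnitAddCircle → ℝ),
      Q.map (fun a ↦ ∑ x ∈ I, c x * Φ x a) = gaussianReal 0 (∑ x ∈ I, ∑ y ∈ I, c x * c y *
        maternCovariogram (1 / 2) σ α x y).toNNReal := by
    intro I c
    refine map_eq_gaussianReal_of_tendstoInMeasure
      (b := fun n ↦ ∑ x ∈ I, c x * circleEigenfunction n x) ?_ hF ?_
    · have := hasSum_sum fun x (_ : x ∈ I) ↦ hasSum_sum fun y (_ : y ∈ I) ↦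
        (hk x y).mul_left (c x * c y)
      refine this.congr_fun fun n ↦ ?_
      rw [Real.coe_toNNReal _ (hs0 n), sq, Finset.sum_mul_sum, Finset.sum_mul]
      refine Finset.sum_congr rfl fun x _ ↦ ?_
      rw [Finset.sum_mul]
      exact Finset.sum_congr rfl fun y _ ↦ by ring
    · have := TendstoInMeasure.sum_const_mul_real I c hΦ
      refine this.congr_left fun N ↦ ae_of_all _ fun a ↦ ?_
      simp only [Finset.mul_sum, Finset.sum_mul]
      rw [Finset.sum_comm]
      exact Finset.sum_congr rfl fun n _ ↦ Finset.sum_congr rfl fun x _ ↦ by ring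
  have hsingle : ∀ x, Q.map (Φ x) = gaussianReal 0 (maternCovariogram (1 / 2) σ α x x).toNNReal := by
    intro x
    simpa using hlin {x} 1
  have hkx : ∀ x, 0 ≤ maternCovariogram (1 / 2) σ α x x := fun x ↦
    (hk x x).nonneg fun n ↦ by rw [mul_assoc]; exact mul_nonneg (hs0 n) (mul_self_nonneg _)
  have hlaw : ∀ x, HasLaw (Φ x) (gaussianReal 0 (maternCovariogram (1 / 2) σ α x x).toNNReal) Q :=
    fun x ↦ ⟨(hΦm x).aemeasurable, hsingle x⟩
  have hL2 : ∀ x, MemLp (Φ x) 2 Q := fun x ↦ (hlaw x).hasGaussianLaw.memLp_two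
  refine ⟨⟨fun I ↦ ⟨?_⟩⟩, fun x ↦ ?_, fun x y ↦ ?_⟩
  · refine isGaussian_of_map_eq_gaussianReal fun L ↦ ?_
    refine ⟨0, (∑ x ∈ I, ∑ y ∈ I, (if h : x ∈ I then L (Pi.single ⟨x, h⟩ 1) else 0) *
      (if h : y ∈ I then L (Pi.single ⟨y, h⟩ 1) else 0) *
      maternCovariogram (1 / 2) σ α x y).toNNReal, ?_⟩
    rw [Measure.map_map (by fun_prop) (by fun_prop), Measure.map_map (by fun_prop) hmeas,
      ← hlin I (fun x ↦ if h : x ∈ I then L (Pi.single ⟨x, h⟩ 1) else 0)]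
    congr 1
    ext a
    simp only [Function.comp_apply]
    rw [← Finset.sum_attach]
    conv_lhs => rw [← ContinuousLinearMap.coe_coe, LinearMap.pi_apply_eq_sum_univ]
    refine Finset.sum_congr rfl fun i _ ↦ ?_
    simp only [Finset.restrict, smul_eq_mul, ContinuousLinearMap.coe_coe, i.2, dif_pos]
    rw [mul_comm]
    congr 2
    ext j
    simp [Pi.single_apply, eq_comm]
  · rw [integral_map hmeas.aemeasurable (measurable_pi_apply x).aestronglyMeasurable]
    rw [(hlaw x).integral_eq, integral_id_gaussianReal]
  · rw [covariance_map_fun (measurable_pi_apply x).aestronglyMeasurable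
      (measurable_pi_apply y).aestronglyMeasurable hmeas.aemeasurable]
    by_cases hxy : x = y
    · subst hxy
      rw [covariance_self (hΦm x).aemeasurable, (hlaw x).variance_eq, variance_id_gaussianReal,
        Real.coe_toNNReal _ (hkx x)]
    -- the covariance by polarization, from the variance of the sum of two values
    have hc : ∀ x y, maternCovariogram (1 / 2) σ α x y = maternCovariogram (1 / 2) σ α y x :=
      fun x y ↦ (hk x y).unique ((hk y x).congr_fun fun n ↦ by ring)
    have hsum : Q.map (fun a ↦ Φ x a + Φ y a) = gaussianReal 0
        (maternCovariogram (1 / 2) σ α x x + 2 * maternCovariogram (1 / 2) σ α x y +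
          maternCovariogram (1 / 2) σ α y y).toNNReal := by
      have := hlin {x, y} 1
      simp only [Finset.sum_pair hxy, Pi.one_apply, one_mul, hc y x] at this
      rw [this]
      congr 2
      ring
    have hnn : 0 ≤ maternCovariogram (1 / 2) σ α x x + 2 * maternCovariogram (1 / 2) σ α x y +
          maternCovariogram (1 / 2) σ α y y := by
      refine (((hk x x).add ((hk x y).mul_left 2)).add (hk y y)).nonneg fun n ↦ ?_
      have : s n * circleEigenfunction n x * circleEigenfunction n x +
          2 * (s n * circleEigenfunction n x * circleEigenfunction n y) +
          s n * circleEigenfunction n y * circleEigenfunction n y =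
          s n * (circleEigenfunction n x + circleEigenfunction n y) ^ 2 := by ring
      rw [this]
      exact mul_nonneg (hs0 n) (sq_nonneg _)
    have hlaw2 : HasLaw (fun a ↦ Φ x a + Φ y a) _ Q :=
      ⟨((hΦm x).add (hΦm y)).aemeasurable, hsum⟩
    have hv := variance_fun_add (hL2 x) (hL2 y)
    rw [hlaw2.variance_eq, (hlaw x).variance_eq, (hlaw y).variance_eq, variance_id_gaussianReal,
      variance_id_gaussianReal, variance_id_gaussianReal, Real.coe_toNNReal _ (hkx x),
      Real.coe_toNNReal _ (hkx y), Real.coe_toNNReal _ hnn] at hv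
    linarith

lemma exists_tendstoInMeasure_fourierSeries {A α : ℝ} (hA : 0 < A) (hα : 0 < α) {F : ℕ → Finset ℤ}
    (hF : Tendsto F atTop atTop) (x : UnitAddCircle) :
    ∃ Y : (ℤ → ℝ) → ℝ, Measurable Y ∧ TendstoInMeasure (Measure.infinitePi fun n ↦
      gaussianReal 0 (spectralVar A α n).toNNReal)
        (fun N a ↦ ∑ n ∈ F N, circleEigenfunction n x * a n) atTop Y := by
  refine exists_tendstoInMeasure_sum_mul (fun n ↦ ?_) ?_ hF
  · simpa using spectralVar_pos hA hα n
  · refine (summable_weight_mul_circleEigenfunction (summable_spectralVar A hα) x x).congr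
      fun n ↦ ?_
    rw [Real.coe_toNNReal _ (spectralVar_pos hA hα n).le]
    ring

lemma exists_isMaternMeasure {σ α : ℝ} (hσ : 0 < σ) (hα : 0 < α) :
    ∃ P, IsMaternMeasure (1 / 2) σ α P := by
  obtain ⟨F, -, hF⟩ := exists_seq_monotone_tendsto_atTop_atTop (Finset ℤ)
  choose Φ hΦm hΦ using exists_tendstoInMeasure_fourierSeries (microergodic_pos hσ hα) hα hF
  exact ⟨_, isMaternMeasure_map hσ hα hF hΦm hΦ⟩

/-! ### Tilting an infinite product measure -/

section Tilt

variable {ι : Type*} {X : ι → Type*} [∀ i, MeasurableSpace (X i)]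
  {μ μ' : ∀ i, Measure (X i)} [∀ i, IsProbabilityMeasure (μ i)] [∀ i, IsProbabilityMeasure (μ' i)]

lemma lintegral_prod_infinitePi {h : ∀ i, X i → ℝ≥0∞} (hh : ∀ i, Measurable (h i))
    (F : Finset ι) :
    ∫⁻ a, ∏ n ∈ F, h n (a n) ∂(Measure.infinitePi μ) = ∏ n ∈ F, ∫⁻ x, h n x ∂(μ n) := by
  rw [lintegral_prod_eq_prod_lintegral_of_indepFun F (fun n (a : ∀ i, X i) ↦ h n (a n))
    (iIndepFun_infinitePi hh) fun n ↦ by fun_prop]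
  refine Finset.prod_congr rfl fun n _ ↦ ?_
  conv_rhs => rw [← Measure.infinitePi_map_eval μ n, lintegral_map (hh n) (by fun_prop)]

/-- If `μ' i` is proportional to `μ i` with density `g i ≤ 1`, then the infinite products are
equivalent as soon as the infinite product of the densities does not vanish almost surely: it is a
density of the second product up to a constant. The infinite product is an infimum over finite sets
of indices, since its factors are at most `1`. -/
lemma absolutelyContinuous_infinitePi_of_withDensity [Countable ι] {g : ∀ i, X i → ℝ≥0∞}
    (hg : ∀ i, Measurable (g i)) (hg1 : ∀ i x, g i x ≤ 1) {m : ι → ℝ≥0∞}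
    (hm : ∀ i, (μ i).withDensity (g i) = m i • μ' i)
    (hpos : ∀ᵐ a ∂(Measure.infinitePi μ), (⨅ F : Finset ι, ∏ n ∈ F, g n (a n)) ≠ 0) :
    Measure.infinitePi μ' ≪ Measure.infinitePi μ ∧
      Measure.infinitePi μ ≪ Measure.infinitePi μ' := by
  classical
  set Q := Measure.infinitePi μ
  set G : (∀ i, X i) → ℝ≥0∞ := fun a ↦ ⨅ F : Finset ι, ∏ n ∈ F, g n (a n) with hG
  have hGF : ∀ F : Finset ι, Measurable fun a : ∀ i, X i ↦ ∏ n ∈ F, g n (a n) := fun F ↦ by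
    fun_prop
  have hGm : Measurable G := Measurable.iInf hGF
  set K : ℝ≥0∞ := ⨅ F : Finset ι, ∏ n ∈ F, m n with hK
  have hmg : ∀ i, m i = ∫⁻ x, g i x ∂(μ i) := fun i ↦ by
    rw [← setLIntegral_univ, ← withDensity_apply _ .univ, hm i]
    simp
  have hm1 : ∀ i, m i ≤ 1 := fun i ↦ by
    rw [hmg i]
    exact (lintegral_mono (hg1 i)).trans (by simp)
  have hanti : ∀ a : ∀ i, X i, Antitone fun F : Finset ι ↦ ∏ n ∈ F, g n (a n) := fun a F F' h ↦
    Finset.prod_le_prod_of_subset_of_le_one' h fun i _ _ ↦ hg1 i _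
  have hprod1 : ∀ (a : ∀ i, X i) (F : Finset ι), ∏ n ∈ F, g n (a n) ≤ 1 := fun a F ↦
    Finset.prod_le_one' fun i _ ↦ hg1 i _
  have hKlim : Tendsto (fun F : Finset ι ↦ ∏ n ∈ F, m n) atTop (𝓝 K) :=
    tendsto_atTop_iInf fun F F' h ↦ Finset.prod_le_prod_of_subset_of_le_one' h fun i _ _ ↦ hm1 i
  -- the tilted measure of a box
  have hbox : ∀ (s : Finset ι) (t : ∀ i, Set (X i)), (∀ i, MeasurableSet (t i)) →
      Q.withDensity G (Set.pi s t) = K * ∏ i ∈ s, μ' i (t i) := by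
    intro s t ht
    have hbm : MeasurableSet (Set.pi (s : Set ι) t) :=
      MeasurableSet.pi s.countable_toSet fun i _ ↦ ht i
    rw [withDensity_apply _ hbm]
    have h1 : Tendsto (fun F : Finset ι ↦ ∫⁻ a in Set.pi s t, ∏ n ∈ F, g n (a n) ∂Q) atTop
        (𝓝 (∫⁻ a in Set.pi s t, G a ∂Q)) := by
      refine tendsto_lintegral_filter_of_dominated_convergence (fun _ ↦ 1)
        (.of_forall hGF) (.of_forall fun F ↦ ae_of_all _ fun a ↦ hprod1 a F) (by simp)
        (ae_of_all _ fun a ↦ tendsto_atTop_iInf (hanti a))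
    refine tendsto_nhds_unique h1 ?_
    have h2 := ENNReal.Tendsto.mul_const (b := ∏ i ∈ s, μ' i (t i)) hKlim
      (.inr (ENNReal.prod_ne_top fun i _ ↦ measure_ne_top _ _))
    refine h2.congr' ?_
    filter_upwards [eventually_ge_atTop s] with F hF
    have h3 : ∀ a, (Set.pi (s : Set ι) t).indicator (fun a ↦ ∏ n ∈ F, g n (a n)) a =
        ∏ n ∈ F, (if n ∈ s then t n else Set.univ).indicator (g n) (a n) := by
      intro a
      by_cases ha : a ∈ Set.pi (s : Set ι) t
      · rw [Set.indicator_of_mem ha]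
        refine Finset.prod_congr rfl fun n _ ↦ ?_
        rw [Set.indicator_of_mem]
        split_ifs with hn
        · exact ha n hn
        · trivial
      · rw [Set.indicator_of_notMem ha]
        simp only [Set.mem_pi, not_forall] at ha
        obtain ⟨n, hn, hna⟩ := ha
        have hn' : n ∈ s := hn
        refine (Finset.prod_eq_zero (hF hn') ?_).symm
        rw [if_pos hn', Set.indicator_of_notMem hna]
    have hsm : ∀ n, MeasurableSet (if n ∈ s then t n else Set.univ) := fun n ↦ by
      split_ifs
      exacts [ht n, .univ]
    rw [← lintegral_indicator hbm]
    simp_rw [h3]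
    rw [lintegral_prod_infinitePi fun n ↦ (hg n).indicator (hsm n)]
    have h4 : ∀ n, ∫⁻ x, (if n ∈ s then t n else Set.univ).indicator (g n) x ∂(μ n) =
        m n * (if n ∈ s then μ' n (t n) else 1) := by
      intro n
      rw [lintegral_indicator (hsm n), ← withDensity_apply _ (hsm n), hm n]
      split_ifs <;> simp
    simp_rw [h4]
    rw [Finset.prod_mul_distrib, Finset.prod_ite_mem, Finset.inter_eq_right.2 hF]
  have hKG : K = ∫⁻ a, G a ∂Q := by
    have := hbox ∅ (fun _ ↦ Set.univ) fun _ ↦ .univ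
    simpa using this.symm
  have hK0 : K ≠ 0 := by
    rw [hKG, Ne, lintegral_eq_zero_iff hGm]
    intro h
    obtain ⟨a, h1, h2⟩ := (hpos.and h).exists
    exact h1 h2
  have hKt : K ≠ ∞ := ((iInf_le _ ∅).trans_lt (by simp)).ne
  have hQ' : K⁻¹ • Q.withDensity G = Measure.infinitePi μ' := by
    refine Measure.eq_infinitePi _ fun s t ht ↦ ?_
    rw [Measure.smul_apply, hbox s t ht, smul_eq_mul, ← mul_assoc, ENNReal.inv_mul_cancel hK0 hKt,
      one_mul]
  rw [← hQ']
  refine ⟨(withDensity_absolutelyContinuous Q G).smul_left _, ?_⟩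
  exact (withDensity_absolutelyContinuous' hGm.aemeasurable hpos).trans
    (Measure.absolutelyContinuous_smul (ENNReal.inv_ne_zero.2 hKt))

end Tilt

lemma gaussianReal_withDensity_exp_sq {v w : ℝ≥0} (hv : v ≠ 0) (hw : w ≠ 0) {c : ℝ}
    (h : (w : ℝ)⁻¹ = (v : ℝ)⁻¹ + 2 * c) :
    (gaussianReal 0 v).withDensity (fun x ↦ ENNReal.ofReal (Real.exp (-(c * x ^ 2)))) =
      ENNReal.ofReal (√(w / v)) • gaussianReal 0 w := by
  rw [gaussianReal_of_var_ne_zero _ hv, gaussianReal_of_var_ne_zero _ hw,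
    ← withDensity_mul _ (by fun_prop) (by fun_prop), ← withDensity_smul _ (by fun_prop)]
  congr 1
  ext x
  have hv' : (0 : ℝ) < v := by positivity
  have hw' : (0 : ℝ) < w := by positivity
  simp only [Pi.mul_apply, Pi.smul_apply, gaussianPDF, smul_eq_mul]
  rw [← ENNReal.ofReal_mul (gaussianPDFReal_nonneg _ _ _), ← ENNReal.ofReal_mul (by positivity)]
  congr 1
  simp only [gaussianPDFReal, sub_zero]
  rw [mul_assoc, ← Real.exp_add, ← mul_assoc]
  congr 1
  · rw [Real.sqrt_div hw'.le, Real.sqrt_mul (by positivity) (v : ℝ),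
      Real.sqrt_mul (by positivity) (w : ℝ)]
    have h1 := Real.sqrt_pos.2 hv'
    have h2 := Real.sqrt_pos.2 hw'
    have h3 : 0 < √(2 * Real.pi) := by positivity
    field_simp
  · congr 1
    have h1 : x ^ 2 / (2 * w) = x ^ 2 / (2 * v) + c * x ^ 2 := by
      have : x ^ 2 / (2 * w) = x ^ 2 / 2 * (w : ℝ)⁻¹ := by field_simp
      rw [this, h]
      field_simp
    rw [neg_div, neg_div, h1]
    ring

lemma ae_summable_sq_infinitePi_gaussianReal {ι : Type*} [Countable ι] {s : ι → ℝ≥0}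
    (hs : Summable s) :
    ∀ᵐ a ∂(Measure.infinitePi fun n ↦ gaussianReal 0 (s n)), Summable fun n ↦ a n ^ 2 := by
  set Q := Measure.infinitePi fun n ↦ gaussianReal 0 (s n)
  have hfin : ∫⁻ a, ∑' n, ENNReal.ofReal (a n ^ 2) ∂Q ≠ ∞ := by
    rw [lintegral_tsum fun n ↦ by
      have : Measurable fun a : ι → ℝ ↦ ENNReal.ofReal (a n ^ 2) := by fun_prop
      exact this.aemeasurable]
    have : ∀ n, ∫⁻ a, ENNReal.ofReal (a n ^ 2) ∂Q = s n := by
      intro n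
      have hlaw : HasLaw (fun a : ι → ℝ ↦ a n) (gaussianReal 0 (s n)) Q :=
        ⟨(measurable_pi_apply n).aemeasurable, Measure.infinitePi_map_eval _ n⟩
      have h2 := hlaw.hasGaussianLaw.memLp_two
      rw [← ofReal_integral_eq_lintegral_ofReal h2.integrable_sq
        (ae_of_all _ fun a ↦ sq_nonneg _), ← variance_of_integral_eq_zero
        (measurable_pi_apply n).aemeasurable (by rw [hlaw.integral_eq, integral_id_gaussianReal]),
        hlaw.variance_eq, variance_id_gaussianReal, ENNReal.ofReal_coe_nnreal]
    simp_rw [this]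
    exact ENNReal.tsum_coe_ne_top_iff_summable.2 hs
  filter_upwards [ae_lt_top (by fun_prop) hfin] with a ha
  have := ENNReal.summable_toReal ha.ne
  exact this.congr fun n ↦ ENNReal.toReal_ofReal (sq_nonneg _)

/-- Two products of centred Gaussian measures whose precisions all differ by the same `2 c ≥ 0`
are equivalent: one has a density proportional to `exp (-c ∑ aₙ²)`, and `∑ aₙ²` is finite. -/
lemma infinitePi_gaussianReal_absolutelyContinuous {ι : Type*} [Countable ι] {s r : ι → ℝ≥0}
    (hs : ∀ n, s n ≠ 0) (hr : ∀ n, r n ≠ 0) (hsum : Summable s) {c : ℝ} (hc : 0 ≤ c)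
    (h : ∀ n, (r n : ℝ)⁻¹ = (s n : ℝ)⁻¹ + 2 * c) :
    (Measure.infinitePi fun n ↦ gaussianReal 0 (r n)) ≪
        (Measure.infinitePi fun n ↦ gaussianReal 0 (s n)) ∧
      (Measure.infinitePi fun n ↦ gaussianReal 0 (s n)) ≪
        (Measure.infinitePi fun n ↦ gaussianReal 0 (r n)) := by
  refine absolutelyContinuous_infinitePi_of_withDensity
    (g := fun _ x ↦ ENNReal.ofReal (Real.exp (-(c * x ^ 2)))) (fun _ ↦ by fun_prop)
    (fun _ x ↦ ?_) (fun n ↦ gaussianReal_withDensity_exp_sq (hs n) (hr n) (h n)) ?_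
  · rw [ENNReal.ofReal_le_one, Real.exp_le_one_iff]
    have := mul_nonneg hc (sq_nonneg x)
    linarith
  · filter_upwards [ae_summable_sq_infinitePi_gaussianReal hsum] with a ha
    have hle : ENNReal.ofReal (Real.exp (-(c * ∑' n, a n ^ 2))) ≤
        ⨅ F : Finset ι, ∏ n ∈ F, ENNReal.ofReal (Real.exp (-(c * a n ^ 2))) := by
      refine le_iInf fun F ↦ ?_
      rw [← ENNReal.ofReal_prod_of_nonneg fun n _ ↦ (Real.exp_pos _).le, ← Real.exp_sum]
      refine ENNReal.ofReal_le_ofReal (Real.exp_le_exp.2 ?_)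
      rw [Finset.sum_neg_distrib, ← Finset.mul_sum]
      exact neg_le_neg (mul_le_mul_of_nonneg_left (ha.sum_le_tsum F fun n _ ↦ sq_nonneg _) hc)
    refine (lt_of_lt_of_le ?_ hle).ne'
    rw [ENNReal.ofReal_pos]
    exact Real.exp_pos _

/-! ### Equivalence of the Matérn measures with a common microergodic parameter -/

/-- Both measures are images of equivalent products under the same map `a ↦ ∑ aₙ fₙ`. The map is
built for the smaller decay, whose coefficients have the larger variances. -/
lemma IsMaternMeasure.absolutelyContinuous_of_le {σ₁ α₁ σ₂ α₂ : ℝ} (hσ₁ : 0 < σ₁) (hα₁ : 0 < α₁)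
    (hσ₂ : 0 < σ₂) (hα₂ : 0 < α₂) {P₁ P₂ : Measure (UnitAddCircle → ℝ)}
    (h₁ : IsMaternMeasure (1 / 2) σ₁ α₁ P₁) (h₂ : IsMaternMeasure (1 / 2) σ₂ α₂ P₂)
    (h : microergodic σ₁ α₁ = microergodic σ₂ α₂) (hle : α₂ ≤ α₁) : P₁ ≪ P₂ ∧ P₂ ≪ P₁ := by
  have hA := microergodic_pos hσ₂ hα₂
  set A := microergodic σ₂ α₂ with hAdef
  have hpos₁ := spectralVar_pos hA hα₁
  have hpos₂ := spectralVar_pos hA hα₂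
  have hc : 0 ≤ (α₁ ^ 2 - α₂ ^ 2) / (4 * A) := by
    have : α₂ ^ 2 ≤ α₁ ^ 2 := by gcongr
    exact div_nonneg (by linarith) (by positivity)
  obtain ⟨hac, hac'⟩ := infinitePi_gaussianReal_absolutelyContinuous
    (s := fun n ↦ (spectralVar A α₂ n).toNNReal) (r := fun n ↦ (spectralVar A α₁ n).toNNReal)
    (fun n ↦ by simpa using hpos₂ n) (fun n ↦ by simpa using hpos₁ n)
    (summable_spectralVar A hα₂).toNNReal hc (fun n ↦ by
      rw [Real.coe_toNNReal _ (hpos₁ n).le, Real.coe_toNNReal _ (hpos₂ n).le]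
      unfold spectralVar
      field_simp
      ring)
  obtain ⟨F, -, hF⟩ := exists_seq_monotone_tendsto_atTop_atTop (Finset ℤ)
  choose Φ hΦm hΦ using exists_tendstoInMeasure_fourierSeries hA hα₂ hF
  have hΦ' := fun x ↦ (hΦ x).of_absolutelyContinuous hac fun N ↦ by fun_prop
  have hM₂ := isMaternMeasure_map hσ₂ hα₂ hF hΦm hΦ
  rw [← h] at hΦ'
  have hM₁ := isMaternMeasure_map hσ₁ hα₁ hF hΦm hΦ'
  rw [h₁.eq_of_covariogram_eq hM₁ fun _ _ ↦ rfl, h₂.eq_of_covariogram_eq hM₂ fun _ _ ↦ rfl, h]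
  have hm : Measurable fun (a : ℤ → ℝ) (x : UnitAddCircle) ↦ Φ x a := measurable_pi_lambda _ hΦm
  exact ⟨hac.map hm, hac'.map hm⟩

lemma IsMaternMeasure.absolutelyContinuous {σ₁ α₁ σ₂ α₂ : ℝ} (hσ₁ : 0 < σ₁) (hα₁ : 0 < α₁)
    (hσ₂ : 0 < σ₂) (hα₂ : 0 < α₂) {P₁ P₂ : Measure (UnitAddCircle → ℝ)}
    (h₁ : IsMaternMeasure (1 / 2) σ₁ α₁ P₁) (h₂ : IsMaternMeasure (1 / 2) σ₂ α₂ P₂)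
    (h : microergodic σ₁ α₁ = microergodic σ₂ α₂) : P₁ ≪ P₂ ∧ P₂ ≪ P₁ := by
  rcases le_total α₂ α₁ with hle | hle
  · exact absolutelyContinuous_of_le hσ₁ hα₁ hσ₂ hα₂ h₁ h₂ h hle
  · exact (absolutelyContinuous_of_le hσ₂ hα₂ hσ₁ hα₁ h₂ h₁ h.symm hle).symm

/-! ### Second moments of quadratic forms in Gaussian variables -/

section GaussianMoments

variable {Ω : Type*} {mΩ : MeasurableSpace Ω} {P : Measure Ω}

lemma integral_pow_four_gaussianReal (v : ℝ≥0) : ∫ x, x ^ 4 ∂(gaussianReal 0 v) = 3 * (v : ℝ) ^ 2 := by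
  have h := iteratedDeriv_mgf_zero (X := id) (μ := gaussianReal 0 v) (by simp) 4
  simp only [Pi.pow_apply, id] at h
  rw [← h, mgf_id_gaussianReal]
  have hd : ∀ (p : ℝ → ℝ) (p' : ℝ → ℝ), (∀ t, HasDerivAt p (p' t) t) →
      deriv (fun t ↦ p t * Real.exp (0 * t + v * t ^ 2 / 2)) =
        fun t ↦ (p' t + v * t * p t) * Real.exp (0 * t + v * t ^ 2 / 2) := by
    intro p p' hp
    ext t
    have h1 : HasDerivAt (fun t : ℝ ↦ 0 * t + v * t ^ 2 / 2) (v * t) t := by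
      have := ((hasDerivAt_pow 2 t).const_mul (v : ℝ)).div_const 2
      convert! this using 1
      · ext t; simp
      · simp; ring
    refine ((hp t).fun_mul h1.exp).deriv.trans ?_
    ring
  have h0 : (fun t : ℝ ↦ Real.exp (0 * t + v * t ^ 2 / 2)) =
      fun t ↦ (fun _ ↦ (1 : ℝ)) t * Real.exp (0 * t + v * t ^ 2 / 2) := by simp
  rw [h0, iteratedDeriv_succ', iteratedDeriv_succ', iteratedDeriv_succ', iteratedDeriv_succ',
    iteratedDeriv_zero, hd _ (fun _ ↦ 0) fun t ↦ hasDerivAt_const t _,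
    hd _ (fun _ ↦ (v : ℝ)) fun t ↦ by simpa using (hasDerivAt_id t).const_mul (v : ℝ),
    hd _ (fun t ↦ 2 * (v : ℝ) ^ 2 * t) fun t ↦ by
      convert! (((hasDerivAt_pow 2 t).const_mul ((v : ℝ) ^ 2)).const_add (v : ℝ)) using 1
      · ext t; simp; ring
      · simp; ring,
    hd _ (fun t ↦ 3 * (v : ℝ) ^ 2 + 3 * (v : ℝ) ^ 3 * t ^ 2) fun t ↦ by
      convert! (((hasDerivAt_id t).const_mul (3 * (v : ℝ) ^ 2)).add
        ((hasDerivAt_pow 3 t).const_mul ((v : ℝ) ^ 3))) using 1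
      · ext t; simp; ring
      · simp; ring]
  simp

lemma ProbabilityTheory.HasGaussianLaw.integral_pow_four {X : Ω → ℝ} (hX : HasGaussianLaw X P)
    (h0 : ∫ ω, X ω ∂P = 0) : ∫ ω, X ω ^ 4 ∂P = 3 * (∫ ω, X ω ^ 2 ∂P) ^ 2 := by
  have h := hX.map_eq_gaussianReal
  have hm := hX.aemeasurable
  rw [h0] at h
  have h1 : ∫ ω, X ω ^ 4 ∂P = ∫ x, x ^ 4 ∂(P.map X) := by
    rw [integral_map hm (by fun_prop)]
  rw [h1, h, integral_pow_four_gaussianReal, Real.coe_toNNReal _ (variance_nonneg _ _),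
    variance_of_integral_eq_zero hm h0]

lemma ProbabilityTheory.HasGaussianLaw.integrable_pow {X : Ω → ℝ} (hX : HasGaussianLaw X P)
    (n : ℕ) : Integrable (fun ω ↦ X ω ^ n) P := by
  have := hX.isProbabilityMeasure
  have hm := hX.aemeasurable
  rw [← integrable_norm_iff (hm.pow_const n).aestronglyMeasurable]
  simp_rw [norm_pow]
  exact (hX.memLp (p := n) (by simp)).integrable_norm_pow'

lemma ProbabilityTheory.HasGaussianLaw.integrable_mul {X Y : Ω → ℝ} (hX : HasGaussianLaw X P)
    (hY : HasGaussianLaw Y P) : Integrable (fun ω ↦ X ω * Y ω) P :=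
  hX.memLp_two.integrable_mul hY.memLp_two

lemma ProbabilityTheory.HasGaussianLaw.integrable_sq_mul_sq {X Y : Ω → ℝ} (hX : HasGaussianLaw X P)
    (hY : HasGaussianLaw Y P) : Integrable (fun ω ↦ X ω ^ 2 * Y ω ^ 2) P := by
  refine ((hX.integrable_pow 4).add (hY.integrable_pow 4)).mono' ?_ (ae_of_all _ fun ω ↦ ?_)
  · have := hX.aemeasurable
    have := hY.aemeasurable
    fun_prop
  · rw [Real.norm_of_nonneg (by positivity)]
    simp only [Pi.add_apply]
    nlinarith [sq_nonneg (X ω ^ 2 - Y ω ^ 2), sq_nonneg (X ω ^ 2), sq_nonneg (Y ω ^ 2)]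

/-- The case of two pairs in Isserlis' theorem, by polarization of the fourth moment. -/
lemma ProbabilityTheory.HasGaussianLaw.integral_sq_mul_sq {X Y : Ω → ℝ}
    (hXY : HasGaussianLaw (fun ω ↦ (X ω, Y ω)) P) (hX0 : ∫ ω, X ω ∂P = 0)
    (hY0 : ∫ ω, Y ω ∂P = 0) :
    ∫ ω, X ω ^ 2 * Y ω ^ 2 ∂P =
      (∫ ω, X ω ^ 2 ∂P) * (∫ ω, Y ω ^ 2 ∂P) + 2 * (∫ ω, X ω * Y ω ∂P) ^ 2 := by
  have hX := hXY.fst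
  have hY := hXY.snd
  have hadd := hXY.fun_add
  have hsub := hXY.fun_sub
  have hXi := hX.integrable
  have hYi := hY.integrable
  have e1 := hX.integral_pow_four hX0
  have e2 := hY.integral_pow_four hY0
  have e3 := hadd.integral_pow_four (by rw [integral_add hXi hYi, hX0, hY0, add_zero])
  have e4 := hsub.integral_pow_four (by rw [integral_sub hXi hYi, hX0, hY0, sub_zero])
  have iXX := hX.integrable_pow 2
  have iYY := hY.integrable_pow 2
  have iXY := hX.integrable_mul hY
  have q3 : ∫ ω, (X ω + Y ω) ^ 2 ∂P =
      ∫ ω, X ω ^ 2 ∂P + 2 * ∫ ω, X ω * Y ω ∂P + ∫ ω, Y ω ^ 2 ∂P := by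
    have i : Integrable (fun ω ↦ X ω ^ 2 + 2 * (X ω * Y ω)) P := iXX.add (iXY.const_mul 2)
    rw [← integral_const_mul, ← integral_add iXX (iXY.const_mul 2), ← integral_add i iYY]
    congr 1; ext ω; ring
  have q4 : ∫ ω, (X ω - Y ω) ^ 2 ∂P =
      ∫ ω, X ω ^ 2 ∂P - 2 * ∫ ω, X ω * Y ω ∂P + ∫ ω, Y ω ^ 2 ∂P := by
    have i : Integrable (fun ω ↦ X ω ^ 2 - 2 * (X ω * Y ω)) P := iXX.sub (iXY.const_mul 2)
    rw [← integral_const_mul, ← integral_sub iXX (iXY.const_mul 2), ← integral_add i iYY]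
    congr 1; ext ω; ring
  have key : 12 * ∫ ω, X ω ^ 2 * Y ω ^ 2 ∂P = ∫ ω, (X ω + Y ω) ^ 4 ∂P + ∫ ω, (X ω - Y ω) ^ 4 ∂P
      - 2 * ∫ ω, X ω ^ 4 ∂P - 2 * ∫ ω, Y ω ^ 4 ∂P := by
    have i3 := hadd.integrable_pow 4
    have i4 := hsub.integrable_pow 4
    have i1 := (hX.integrable_pow 4).const_mul 2
    have i2 := (hY.integrable_pow 4).const_mul 2
    have i5 : Integrable (fun ω ↦ (X ω + Y ω) ^ 4 + (X ω - Y ω) ^ 4) P := i3.add i4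
    have i6 : Integrable (fun ω ↦ (X ω + Y ω) ^ 4 + (X ω - Y ω) ^ 4 - 2 * X ω ^ 4) P := i5.sub i1
    rw [← integral_const_mul, ← integral_const_mul, ← integral_const_mul, ← integral_add i3 i4,
      ← integral_sub i5 i1, ← integral_sub i6 i2]
    congr 1; ext ω; ring
  rw [e1, e2, e3, e4, q3, q4] at key
  linarith

lemma integral_sum_sq_sub_sq [IsProbabilityMeasure P] {ι : Type*} (I : Finset ι) {D : ι → Ω → ℝ}
    (hD : ∀ i j, HasGaussianLaw (fun ω ↦ (D i ω, D j ω)) P) (h0 : ∀ i, ∫ ω, D i ω ∂P = 0) (L : ℝ) :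
    Integrable (fun ω ↦ (∑ i ∈ I, D i ω ^ 2 - L) ^ 2) P ∧
    ∫ ω, (∑ i ∈ I, D i ω ^ 2 - L) ^ 2 ∂P =
      (∑ i ∈ I, ∫ ω, D i ω ^ 2 ∂P - L) ^ 2 +
        2 * ∑ i ∈ I, ∑ j ∈ I, (∫ ω, D i ω * D j ω ∂P) ^ 2 := by
  have hG : ∀ i, HasGaussianLaw (D i) P := fun i ↦ (hD i i).fst
  have i1 : ∀ i j, Integrable (fun ω ↦ D i ω ^ 2 * D j ω ^ 2) P :=
    fun i j ↦ (hG i).integrable_sq_mul_sq (hG j)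
  have i2 : ∀ i, Integrable (fun ω ↦ D i ω ^ 2) P := fun i ↦ (hG i).integrable_pow 2
  have hexp : (fun ω ↦ (∑ i ∈ I, D i ω ^ 2 - L) ^ 2) = fun ω ↦
      ∑ i ∈ I, ∑ j ∈ I, D i ω ^ 2 * D j ω ^ 2 - 2 * L * ∑ i ∈ I, D i ω ^ 2 + L ^ 2 := by
    ext ω
    rw [← Finset.sum_mul_sum]
    ring
  have j1 : Integrable (fun ω ↦ ∑ i ∈ I, ∑ j ∈ I, D i ω ^ 2 * D j ω ^ 2) P :=
    integrable_finsetSum _ fun i _ ↦ integrable_finsetSum _ fun j _ ↦ i1 i j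
  have j2 : Integrable (fun ω ↦ 2 * L * ∑ i ∈ I, D i ω ^ 2) P :=
    (integrable_finsetSum _ fun i _ ↦ i2 i).const_mul _
  have j3 : Integrable (fun ω ↦ ∑ i ∈ I, ∑ j ∈ I, D i ω ^ 2 * D j ω ^ 2 -
      2 * L * ∑ i ∈ I, D i ω ^ 2) P := j1.sub j2
  rw [hexp]
  refine ⟨j3.add (integrable_const _), ?_⟩
  rw [integral_add j3 (integrable_const _), integral_sub j1 j2, integral_const_mul,
    integral_finsetSum _ fun i _ ↦ integrable_finsetSum _ fun j _ ↦ i1 i j,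
    integral_finsetSum _ fun i _ ↦ i2 i]
  have : ∀ i ∈ I, ∫ ω, ∑ j ∈ I, D i ω ^ 2 * D j ω ^ 2 ∂P = (∫ ω, D i ω ^ 2 ∂P) *
      (∑ j ∈ I, ∫ ω, D j ω ^ 2 ∂P) + 2 * ∑ j ∈ I, (∫ ω, D i ω * D j ω ∂P) ^ 2 := by
    intro i _
    rw [integral_finsetSum _ fun j _ ↦ i1 i j, Finset.mul_sum, Finset.mul_sum,
      ← Finset.sum_add_distrib]
    exact Finset.sum_congr rfl fun j _ ↦ (hD i j).integral_sq_mul_sq (h0 i) (h0 j)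
  rw [Finset.sum_congr rfl this, Finset.sum_add_distrib, ← Finset.sum_mul, ← Finset.mul_sum]
  simp
  ring

lemma tendstoInMeasure_const_of_integral_sq [IsFiniteMeasure P] {V : ℕ → Ω → ℝ} {L : ℝ}
    (hi : ∀ n, Integrable (fun ω ↦ (V n ω - L) ^ 2) P)
    (h : Tendsto (fun n ↦ ∫ ω, (V n ω - L) ^ 2 ∂P) atTop (𝓝 0)) :
    TendstoInMeasure P V atTop (fun _ ↦ L) := by
  rw [tendstoInMeasure_iff_measureReal_norm]
  intro ε hε
  have h' := h.div_const (ε ^ 2)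
  rw [zero_div] at h'
  refine tendsto_of_tendsto_of_tendsto_of_le_of_le tendsto_const_nhds h'
    (fun _ ↦ measureReal_nonneg) fun n ↦ ?_
  rw [le_div_iff₀ (by positivity), mul_comm]
  refine le_trans ?_ (mul_meas_ge_le_integral_of_nonneg (ae_of_all _ fun ω ↦ sq_nonneg _) (hi n)
    (ε ^ 2))
  refine mul_le_mul_of_nonneg_left (measureReal_mono fun ω hω ↦ ?_) (by positivity)
  simp only [Set.mem_ofPred_eq, Real.norm_eq_abs] at hω ⊢
  rw [← sq_abs (V n ω - L)]
  gcongr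

end GaussianMoments

/-! ### The quadratic variation determines the microergodic parameter -/

/-- The increment of the sample path `Z` over the `j`-th of the `N` arcs into which the points
`j / N` divide the circle. -/
def circleIncrement (N j : ℕ) (Z : UnitAddCircle → ℝ) : ℝ :=
  Z (((j + 1 : ℝ) / N : ℝ) : UnitAddCircle) - Z (((j : ℝ) / N : ℝ) : UnitAddCircle)

/-- The sum of the squared increments of `Z` over the arcs between the points `j / N`. -/
def quadraticVariation (N : ℕ) (Z : UnitAddCircle → ℝ) : ℝ :=
  ∑ j ∈ Finset.range N, circleIncrement N j Z ^ 2

lemma measurable_quadraticVariation (N : ℕ) : Measurable (quadraticVariation N) := by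
  unfold quadraticVariation circleIncrement
  fun_prop

/-- The covariogram for smoothness `1 / 2` as a function of the angle between the points. -/
def angularCovariogram (σ α d : ℝ) : ℝ :=
  σ ^ 2 * (Real.cosh (α * (d - 1 / 2)) / Real.cosh (α / 2))

lemma angularCovariogram_second_difference (σ α d h : ℝ) :
    2 * angularCovariogram σ α d - angularCovariogram σ α (d + h) - angularCovariogram σ α (d - h) =
      -(2 * (Real.cosh (α * h) - 1) * angularCovariogram σ α d) := by
  unfold angularCovariogram
  have h1 : α * (d + h - 1 / 2) = α * (d - 1 / 2) + α * h := by ring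
  have h2 : α * (d - h - 1 / 2) = α * (d - 1 / 2) - α * h := by ring
  rw [h1, h2, Real.cosh_add, Real.cosh_sub]
  ring

lemma abs_angularCovariogram_le (σ α : ℝ) {d : ℝ} (hd : d ∈ Set.Icc 0 1) :
    |angularCovariogram σ α d| ≤ σ ^ 2 := by
  unfold angularCovariogram
  have hC := Real.cosh_pos (α / 2)
  have hC' := Real.cosh_pos (α * (d - 1 / 2))
  rw [abs_of_nonneg (by positivity)]
  refine mul_le_of_le_one_right (sq_nonneg σ) ?_
  rw [div_le_one hC, Real.cosh_le_cosh, abs_mul, abs_div, div_eq_mul_inv]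
  refine mul_le_mul_of_nonneg_left ?_ (abs_nonneg _)
  rw [abs_le]
  obtain ⟨h1, h2⟩ := hd
  norm_num
  constructor <;> linarith

namespace IsMaternMeasure

variable {σ α : ℝ} {P : Measure (UnitAddCircle → ℝ)}

lemma integral_mul_eq (hP : IsMaternMeasure (1 / 2) σ α P) (hα : 0 < α) {a b : ℝ}
    (hab : a - b ∈ Set.Icc 0 1) :
    ∫ Z, Z (a : UnitAddCircle) * Z (b : UnitAddCircle) ∂P = angularCovariogram σ α (a - b) := by
  have := hP.isProbabilityMeasure
  have h := hP.covariance_eq (a : UnitAddCircle) (b : UnitAddCircle)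
  rw [covariance_eq_sub (hP.memLp_two _) (hP.memLp_two _), hP.mean_eq_zero,
    maternCovariogram_half_eq_cosh hα σ hab (by simp)] at h
  simpa [angularCovariogram] using h

lemma integral_increment_mul (hP : IsMaternMeasure (1 / 2) σ α P) (x y z w : UnitAddCircle) :
    ∫ Z, (Z x - Z y) * (Z z - Z w) ∂P =
      ∫ Z, Z x * Z z ∂P - ∫ Z, Z x * Z w ∂P - (∫ Z, Z y * Z z ∂P - ∫ Z, Z y * Z w ∂P) := by
  have hi : ∀ x y : UnitAddCircle, Integrable (fun Z : UnitAddCircle → ℝ ↦ Z x * Z y) P :=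
    fun x y ↦ (hP.memLp_two x).integrable_mul (hP.memLp_two y)
  have h1 : Integrable (fun Z : UnitAddCircle → ℝ ↦ Z x * Z z - Z x * Z w) P :=
    (hi x z).sub (hi x w)
  have h2 : Integrable (fun Z : UnitAddCircle → ℝ ↦ Z y * Z z - Z y * Z w) P :=
    (hi y z).sub (hi y w)
  rw [← integral_sub (hi x z) (hi x w), ← integral_sub (hi y z) (hi y w), ← integral_sub h1 h2]
  congr 1; ext Z; ring

lemma integral_circleIncrement_sq (hP : IsMaternMeasure (1 / 2) σ α P) (hα : 0 < α) {N : ℕ}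
    (hN : 0 < N) (j : ℕ) : ∫ Z, circleIncrement N j Z ^ 2 ∂P =
      2 * (angularCovariogram σ α 0 - angularCovariogram σ α (N : ℝ)⁻¹) := by
  have hN' : (0 : ℝ) < N := by exact_mod_cast hN
  have hN1 : (N : ℝ)⁻¹ ≤ 1 := inv_le_one_of_one_le₀ (by exact_mod_cast hN)
  have hd : (j + 1 : ℝ) / N - (j : ℝ) / N = (N : ℝ)⁻¹ := by field_simp; ring
  simp only [circleIncrement, sq]
  have hc : ∫ Z : UnitAddCircle → ℝ, Z (((j : ℝ) / N : ℝ) : UnitAddCircle) *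
      Z (((j + 1 : ℝ) / N : ℝ) : UnitAddCircle) ∂P = angularCovariogram σ α (N : ℝ)⁻¹ := by
    rw [← hd, ← hP.integral_mul_eq hα (by rw [hd]; exact ⟨by positivity, hN1⟩)]
    congr 1; ext Z; ring
  rw [hP.integral_increment_mul, hc, hP.integral_mul_eq hα (by simp),
    hP.integral_mul_eq hα (a := (j + 1 : ℝ) / N) (b := (j : ℝ) / N)
      (by rw [hd]; exact ⟨by positivity, hN1⟩),
    hP.integral_mul_eq hα (a := (j : ℝ) / N) (by simp)]
  rw [hd, sub_self, sub_self]
  ring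

/-- The covariance of two distinct increments is a second difference of the covariogram away from
the kink at angle `0`, so it is of order `N⁻²`. -/
lemma abs_integral_circleIncrement_mul_le (hP : IsMaternMeasure (1 / 2) σ α P) (hα : 0 < α)
    {N i j : ℕ} (hij : j < i) (hi : i < N) :
    |∫ Z, circleIncrement N i Z * circleIncrement N j Z ∂P| ≤
      2 * σ ^ 2 * (Real.cosh (α * (N : ℝ)⁻¹) - 1) := by
  have hN' : (0 : ℝ) < N := by exact_mod_cast (by omega : 0 < N)
  have h1 : (j : ℝ) + 1 ≤ i := by exact_mod_cast hij
  have h2 : (i : ℝ) + 1 ≤ N := by exact_mod_cast hi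
  have hj : (0 : ℝ) ≤ j := by positivity
  have hmem : ∀ a b : ℝ, b ≤ a → a ≤ b + N → a / N - b / N ∈ Set.Icc (0 : ℝ) 1 := by
    intro a b hab hab'
    rw [← sub_div]
    exact ⟨div_nonneg (by linarith) hN'.le, by rw [div_le_one hN']; linarith⟩
  simp only [circleIncrement]
  rw [hP.integral_increment_mul,
    hP.integral_mul_eq hα (a := (i + 1 : ℝ) / N) (b := (j + 1 : ℝ) / N)
      (hmem _ _ (by linarith) (by linarith)),
    hP.integral_mul_eq hα (a := (i + 1 : ℝ) / N) (b := (j : ℝ) / N)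
      (hmem _ _ (by linarith) (by linarith)),
    hP.integral_mul_eq hα (a := (i : ℝ) / N) (b := (j + 1 : ℝ) / N)
      (hmem _ _ (by linarith) (by linarith)),
    hP.integral_mul_eq hα (a := (i : ℝ) / N) (b := (j : ℝ) / N)
      (hmem _ _ (by linarith) (by linarith))]
  have e1 : (i + 1 : ℝ) / N - (j + 1) / N = i / N - j / N := by ring
  have e2 : (i + 1 : ℝ) / N - j / N = i / N - j / N + (N : ℝ)⁻¹ := by ring
  have e3 : (i : ℝ) / N - (j + 1) / N = i / N - j / N - (N : ℝ)⁻¹ := by ring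
  rw [e1, e2, e3]
  have hk := angularCovariogram_second_difference σ α ((i : ℝ) / N - j / N) (N : ℝ)⁻¹
  have hcosh : 0 ≤ Real.cosh (α * (N : ℝ)⁻¹) - 1 := by linarith [Real.one_le_cosh (α * (N : ℝ)⁻¹)]
  have hb := abs_angularCovariogram_le σ α (hmem i j (by linarith) (by linarith))
  calc _ = |-(2 * (Real.cosh (α * (N : ℝ)⁻¹) - 1) *
        angularCovariogram σ α ((i : ℝ) / N - j / N))| := by rw [← hk]; congr 1; ring
    _ = 2 * (Real.cosh (α * (N : ℝ)⁻¹) - 1) * |angularCovariogram σ α ((i : ℝ) / N - j / N)| := by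
        rw [abs_neg, abs_mul, abs_of_nonneg (by positivity)]
    _ ≤ 2 * (Real.cosh (α * (N : ℝ)⁻¹) - 1) * σ ^ 2 := by gcongr
    _ = _ := by ring

lemma hasGaussianLaw_circleIncrement_prodMk (hP : IsMaternMeasure (1 / 2) σ α P) (N i j : ℕ) :
    HasGaussianLaw (fun Z ↦ (circleIncrement N i Z, circleIncrement N j Z)) P := by
  classical
  have h : IsGaussianProcess (circleIncrement N) P := by
    refine hP.isGaussianProcess.of_isGaussianProcess fun j ↦
      ⟨{(((j + 1 : ℝ) / N : ℝ) : UnitAddCircle), (((j : ℝ) / N : ℝ) : UnitAddCircle)},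
        .proj ⟨(((j + 1 : ℝ) / N : ℝ) : UnitAddCircle), by simp⟩ -
          .proj ⟨(((j : ℝ) / N : ℝ) : UnitAddCircle), by simp⟩, fun Z ↦ ?_⟩
    simp [circleIncrement]
  exact h.hasGaussianLaw_prodMk

lemma integral_circleIncrement (hP : IsMaternMeasure (1 / 2) σ α P) (N j : ℕ) :
    ∫ Z, circleIncrement N j Z ∂P = 0 := by
  have := hP.isProbabilityMeasure
  simp only [circleIncrement]
  rw [integral_sub ((hP.memLp_two _).integrable one_le_two)
    ((hP.memLp_two _).integrable one_le_two), hP.mean_eq_zero, hP.mean_eq_zero, sub_zero]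

/-- The mean square distance of the quadratic variation from `L`, where `v` is the variance of an
increment and `B` bounds the covariance of two distinct increments. -/
lemma integral_quadraticVariation_sub_sq_le (hP : IsMaternMeasure (1 / 2) σ α P) (hα : 0 < α)
    {N : ℕ} (hN : 0 < N) (L : ℝ) {v B : ℝ}
    (hv : v = 2 * (angularCovariogram σ α 0 - angularCovariogram σ α (N : ℝ)⁻¹))
    (hB : B = 2 * σ ^ 2 * (Real.cosh (α * (N : ℝ)⁻¹) - 1)) :
    Integrable (fun Z ↦ (quadraticVariation N Z - L) ^ 2) P ∧
    ∫ Z, (quadraticVariation N Z - L) ^ 2 ∂P ≤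
      (N * v - L) ^ 2 + 2 * (N * v ^ 2 + (N * B) ^ 2) := by
  have := hP.isProbabilityMeasure
  obtain ⟨hint, heq⟩ := integral_sum_sq_sub_sq (Finset.range N)
    (hP.hasGaussianLaw_circleIncrement_prodMk N) (hP.integral_circleIncrement N) L
  refine ⟨hint, ?_⟩
  unfold quadraticVariation
  rw [heq]
  have hdiag : ∀ j, ∫ Z, circleIncrement N j Z ^ 2 ∂P = v := fun j ↦ by
    rw [hv, hP.integral_circleIncrement_sq hα hN]
  simp only [hdiag, Finset.sum_const, Finset.card_range, nsmul_eq_mul]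
  have hoff : ∀ i ∈ Finset.range N, ∀ j ∈ Finset.range N,
      (∫ Z, circleIncrement N i Z * circleIncrement N j Z ∂P) ^ 2 ≤
        (if i = j then v ^ 2 else 0) + B ^ 2 := by
    intro i hi j hj
    rw [Finset.mem_range] at hi hj
    rcases lt_trichotomy i j with hij | rfl | hij
    · have h := hP.abs_integral_circleIncrement_mul_le hα hij hj
      have hcomm : ∫ Z, circleIncrement N i Z * circleIncrement N j Z ∂P =
          ∫ Z, circleIncrement N j Z * circleIncrement N i Z ∂P := by
        congr 1; ext Z; ring
      rw [if_neg hij.ne, zero_add, hcomm, ← sq_abs, hB]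
      gcongr
    · have h := hdiag i
      simp only [sq (circleIncrement N i _)] at h
      rw [h, if_pos rfl]
      linarith [sq_nonneg B]
    · have h := hP.abs_integral_circleIncrement_mul_le hα hij hi
      rw [if_neg hij.ne', zero_add, ← sq_abs, hB]
      gcongr
  have hsum := Finset.sum_le_sum fun i hi ↦ Finset.sum_le_sum (hoff i hi)
  have hcount : ∑ i ∈ Finset.range N, ∑ j ∈ Finset.range N,
      ((if i = j then v ^ 2 else 0) + B ^ 2) = N * v ^ 2 + (N * B) ^ 2 := by
    simp only [Finset.sum_add_distrib, Finset.sum_ite_eq, Finset.sum_const, Finset.card_range,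
      nsmul_eq_mul]
    rw [Finset.sum_ite_mem, Finset.inter_self, Finset.sum_const, Finset.card_range, nsmul_eq_mul]
    ring
  rw [hcount] at hsum
  linarith

/-- The limit is minus twice the right derivative at `0` of the covariogram as a function of the
angle. -/
lemma tendstoInMeasure_quadraticVariation (hP : IsMaternMeasure (1 / 2) σ α P) (hα : 0 < α) :
    TendstoInMeasure P (fun n ↦ quadraticVariation (n + 1)) atTop
      (fun _ ↦ 2 * microergodic σ α) := by
  have := hP.isProbabilityMeasure
  set v : ℕ → ℝ := fun n ↦
    2 * (angularCovariogram σ α 0 - angularCovariogram σ α ((n + 1 : ℕ) : ℝ)⁻¹) with hv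
  set B : ℕ → ℝ := fun n ↦ 2 * σ ^ 2 * (Real.cosh (α * ((n + 1 : ℕ) : ℝ)⁻¹) - 1) with hB
  have hle := fun n ↦ hP.integral_quadraticVariation_sub_sq_le hα n.succ_pos (2 * microergodic σ α)
    (congrFun hv n) (congrFun hB n)
  have hinv : Tendsto (fun n : ℕ ↦ ((n + 1 : ℕ) : ℝ)⁻¹) atTop (𝓝[≠] 0) := by
    refine tendsto_nhdsWithin_iff.2 ⟨?_, .of_forall fun n ↦ ?_⟩
    · simpa using tendsto_one_div_add_atTop_nhds_zero_nat (𝕜 := ℝ)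
    · simp only [Set.mem_compl_iff, Set.mem_singleton_iff]
      positivity
  have hslope : ∀ {f : ℝ → ℝ} {f' : ℝ}, HasDerivAt f f' 0 →
      Tendsto (fun n : ℕ ↦ ((n + 1 : ℕ) : ℝ) * (f ((n + 1 : ℕ) : ℝ)⁻¹ - f 0)) atTop (𝓝 f') := by
    intro f f' hf
    have := (hasDerivAt_iff_tendsto_slope_zero.1 hf).comp hinv
    simpa [Function.comp_def] using this
  have hC := Real.cosh_pos (α / 2)
  have hvlim : Tendsto (fun n : ℕ ↦ ((n + 1 : ℕ) : ℝ) * v n) atTop (𝓝 (2 * microergodic σ α)) := by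
    have hd : HasDerivAt (angularCovariogram σ α)
        (σ ^ 2 * (Real.sinh (α * (0 - 1 / 2)) * α / Real.cosh (α / 2))) 0 := by
      have h1 : HasDerivAt (fun x : ℝ ↦ α * (x - 1 / 2)) α 0 := by
        simpa using ((hasDerivAt_id (0 : ℝ)).sub_const (1 / 2 : ℝ)).const_mul α
      exact (h1.cosh.div_const _).const_mul _
    have := (hslope hd).const_mul (-2)
    have h2 : α * (0 - 1 / 2) = -(α / 2) := by ring
    rw [h2, Real.sinh_neg] at this
    convert! this using 1
    · ext n; rw [hv]; ring
    · rw [microergodic, Real.tanh_eq_sinh_div_cosh]; field_simp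
  have hBlim : Tendsto (fun n : ℕ ↦ ((n + 1 : ℕ) : ℝ) * B n) atTop (𝓝 0) := by
    have hd : HasDerivAt (fun x ↦ 2 * σ ^ 2 * (Real.cosh (α * x) - 1))
        (2 * σ ^ 2 * (Real.sinh (α * 0) * α)) 0 := by
      have h1 : HasDerivAt (fun x : ℝ ↦ α * x) α 0 := by
        simpa using (hasDerivAt_id (0 : ℝ)).const_mul α
      exact (h1.cosh.sub_const _).const_mul _
    have := hslope hd
    simpa [hB] using this
  -- the sum of the squared variances: `N v²` is `(N v)² / N`
  have hv2lim : Tendsto (fun n : ℕ ↦ ((n + 1 : ℕ) : ℝ) * v n ^ 2) atTop (𝓝 0) := by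
    have h0 := (hvlim.pow 2).mul (tendsto_nhdsWithin_iff.1 hinv).1
    rw [mul_zero] at h0
    refine h0.congr fun n ↦ ?_
    have : ((n + 1 : ℕ) : ℝ) ≠ 0 := by positivity
    field_simp
  refine tendstoInMeasure_const_of_integral_sq (fun n ↦ (hle n).1) ?_
  have hlim := ((hvlim.sub_const (2 * microergodic σ α)).pow 2).add
    ((hv2lim.add (hBlim.pow 2)).const_mul 2)
  simp only [sub_self, ne_eq, OfNat.ofNat_ne_zero, not_false_eq_true, zero_pow, add_zero,
    mul_zero] at hlim
  exact tendsto_of_tendsto_of_tendsto_of_le_of_le tendsto_const_nhds hlim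
    (fun n ↦ integral_nonneg fun _ ↦ sq_nonneg _) fun n ↦ (hle n).2

lemma microergodic_eq_of_absolutelyContinuous {σ' α' : ℝ} {P' : Measure (UnitAddCircle → ℝ)}
    (hP : IsMaternMeasure (1 / 2) σ α P) (hP' : IsMaternMeasure (1 / 2) σ' α' P') (hα : 0 < α)
    (hα' : 0 < α') (h : P' ≪ P) : microergodic σ α = microergodic σ' α' := by
  have := hP.isProbabilityMeasure
  have := hP'.isProbabilityMeasure
  have := (hP.tendstoInMeasure_quadraticVariation hα).const_eq_of_absolutelyContinuous h
    (fun n ↦ measurable_quadraticVariation (n + 1)) (hP'.tendstoInMeasure_quadraticVariation hα')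
  linarith

end IsMaternMeasure

/-! ### Failure of consistent estimation -/

/-- A consistent estimator of `g` would separate two equivalent Matérn measures, so `g` can only
depend on the parameters through the microergodic parameter. -/
lemma ConsistentlyEstimable.eq_of_microergodic_eq {g : ℝ → ℝ → ℝ}
    (hg : ConsistentlyEstimable (1 / 2) g) {σ₁ α₁ σ₂ α₂ : ℝ} (hσ₁ : 0 < σ₁) (hα₁ : 0 < α₁)
    (hσ₂ : 0 < σ₂) (hα₂ : 0 < α₂) (h : microergodic σ₁ α₁ = microergodic σ₂ α₂) :
    g σ₁ α₁ = g σ₂ α₂ := by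
  obtain ⟨T, hTm, hT⟩ := hg
  obtain ⟨P₁, h₁⟩ := exists_isMaternMeasure hσ₁ hα₁
  obtain ⟨P₂, h₂⟩ := exists_isMaternMeasure hσ₂ hα₂
  have := h₁.isProbabilityMeasure
  have := h₂.isProbabilityMeasure
  exact (hT σ₁ α₁ hσ₁ hα₁ P₁ h₁).const_eq_of_absolutelyContinuous
    (h₁.absolutelyContinuous hσ₁ hα₁ hσ₂ hα₂ h₂ h).2 hTm (hT σ₂ α₂ hσ₂ hα₂ P₂ h₂)

/-- The microergodic parameter does not determine the spatial variance. -/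
lemma exists_microergodic_eq_of_sq_ne : ∃ σ : ℝ, 0 < σ ∧ σ ^ 2 ≠ 1 ∧
    microergodic 1 1 = microergodic σ 2 := by
  have h1 : 0 < microergodic 1 1 := microergodic_pos one_pos one_pos
  have h2 : 0 < microergodic 1 2 := microergodic_pos one_pos two_pos
  have hlt : microergodic 1 1 < microergodic 1 2 := by
    have ht : Real.tanh (1 / 2) ≤ Real.tanh (2 / 2) := by
      rw [Real.tanh_eq_sinh_div_cosh, Real.tanh_eq_sinh_div_cosh, div_le_div_iff₀
        (Real.cosh_pos _) (Real.cosh_pos _)]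
      have : 0 ≤ Real.sinh (2 / 2 - 1 / 2) := Real.sinh_nonneg_iff.2 (by norm_num)
      rw [Real.sinh_sub] at this
      linarith
    unfold microergodic at h1 ⊢
    norm_num at h1 ht ⊢
    linarith
  have hσ : √(microergodic 1 1 / microergodic 1 2) ^ 2 = microergodic 1 1 / microergodic 1 2 :=
    Real.sq_sqrt (by positivity)
  refine ⟨√(microergodic 1 1 / microergodic 1 2), by positivity, ?_, ?_⟩
  · rw [hσ]
    exact ((div_lt_one h2).2 hlt).ne
  · have h3 : microergodic (√(microergodic 1 1 / microergodic 1 2)) 2 =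
        √(microergodic 1 1 / microergodic 1 2) ^ 2 * microergodic 1 2 := by
      conv_lhs => rw [microergodic]
      conv_rhs => rw [microergodic]
      unfold microergodic
      ring
    rw [h3, hσ]
    field_simp

end

theorem mainTheorem11 :
    (∀ σ α : ℝ, 0 < σ → 0 < α → ∃ P, IsMaternMeasure (1 / 2) σ α P) ∧
    (∀ σ₁ α₁ σ₂ α₂ : ℝ, 0 < σ₁ → 0 < α₁ → 0 < σ₂ → 0 < α₂ →
      ∀ P₁ P₂ : Measure (UnitAddCircle → ℝ),
        IsMaternMeasure (1 / 2) σ₁ α₁ P₁ → IsMaternMeasure (1 / 2) σ₂ α₂ P₂ →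
        ((P₁ ≪ P₂ ∧ P₂ ≪ P₁) ↔
          σ₁ ^ 2 * α₁ * Real.tanh (α₁ / 2) = σ₂ ^ 2 * α₂ * Real.tanh (α₂ / 2))) ∧
    ¬ ConsistentlyEstimable (1 / 2) (fun σ _ ↦ σ ^ 2) ∧
    ¬ ConsistentlyEstimable (1 / 2) (fun _ α ↦ α) := by
  obtain ⟨σ, hσ, hne, h⟩ := exists_microergodic_eq_of_sq_ne
  refine ⟨fun σ α hσ hα ↦ exists_isMaternMeasure hσ hα,
    fun σ₁ α₁ σ₂ α₂ hσ₁ hα₁ hσ₂ hα₂ P₁ P₂ h₁ h₂ ↦ ⟨fun hP ↦ ?_, fun hA ↦ ?_⟩, fun hE ↦ ?_,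
    fun hE ↦ ?_⟩
  · exact h₁.microergodic_eq_of_absolutelyContinuous h₂ hα₁ hα₂ hP.2
  · exact h₁.absolutelyContinuous hσ₁ hα₁ hσ₂ hα₂ h₂ hA
  · have := hE.eq_of_microergodic_eq one_pos one_pos hσ two_pos h
    exact hne (by simpa using this.symm)
  · have := hE.eq_of_microergodic_eq one_pos one_pos hσ two_pos h
    norm_num at this
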